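/- Let $(M,\langle\cdot,\cdot\rangle)$ be a closed (compact, connected, without boundary) smooth Riemannian manifold of dimension $n$ whose Ricci curvature satisfies $\mathrm{Ric}\ge (n-1)\kappa$ for some constant $\kappa\in\mathbb{R}$, that is, $\mathrm{Ric}(v,v)\ge (n-1)\kappa\langle v,v\rangle$ for every tangent vector $v$. Let $g:\mathbb{R}\to\mathbb{R}$ be a continuous function, and suppose that there is a discrete subset $S$ of $[0,+\infty)$ such that $$g(t)\left(\frac{2(n-1)\,t\,g(t)}{n}-3\int_0^t g(\sigma)\,d\sigma-(n-1)\kappa t^2\right)\ \begin{cases}=0,& t\in S,\\ <0,& t\in[0,+\infty)\setminus S.\end{cases}$$ Then every non-negative solution $u\in C^2(M)$ of the equation $\Delta u=-g(u)$ on $M$ is constant, where $\Delta$ is the Laplace–Beltrami operator (the trace of the Hessian). -/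

import Mathlib

open scoped Manifold ContDiff Bundle

noncomputable section

/-- Smooth Riemannian metrics on a manifold `M` modelled on `ℝⁿ`. -/
abbrev SmoothMetric (n : ℕ) (M : Type*) [TopologicalSpace M]
    [ChartedSpace (EuclideanSpace ℝ (Fin n)) M] [IsManifold (𝓡 n) ∞ M] :=
  Bundle.ContMDiffRiemannianMetric (𝓡 n) ∞ (EuclideanSpace ℝ (Fin n))
    (fun x : M ↦ TangentSpace (𝓡 n) x)

namespace LocalGeometry

/-! ### Riemannian geometry in coordinates

Here `G : ℝⁿ → Matrix` is the matrix field `(G_ij)` of a Riemannian metric on an open subset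
of `ℝⁿ`. -/

variable {n : ℕ}

/-- The partial derivative `∂_i f`. -/
def partialDeriv (i : Fin n) (f : EuclideanSpace ℝ (Fin n) → ℝ)
    (y : EuclideanSpace ℝ (Fin n)) : ℝ :=
  fderiv ℝ f y (EuclideanSpace.single i 1)

/-- The Christoffel symbol
`Γ^k_ij = 1/2 ∑_l G^kl (∂_i G_jl + ∂_j G_il - ∂_l G_ij)` of the Levi-Civita connection. -/
def christoffel (G : EuclideanSpace ℝ (Fin n) → Matrix (Fin n) (Fin n) ℝ) (k i j : Fin n)
    (y : EuclideanSpace ℝ (Fin n)) : ℝ :=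
  (1 / 2) * ∑ l, (G y)⁻¹ k l *
    (partialDeriv i (fun z ↦ G z j l) y + partialDeriv j (fun z ↦ G z i l) y
      - partialDeriv l (fun z ↦ G z i j) y)

/-- The components of the Ricci tensor,
`R_ij = ∑_k (∂_k Γ^k_ij - ∂_j Γ^k_ki) + ∑_k ∑_l (Γ^k_kl Γ^l_ij - Γ^k_jl Γ^l_ki)`,
with the sign for which round spheres have positive Ricci curvature. -/
def ricci (G : EuclideanSpace ℝ (Fin n) → Matrix (Fin n) (Fin n) ℝ) (i j : Fin n)
    (y : EuclideanSpace ℝ (Fin n)) : ℝ :=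
  ∑ k, (partialDeriv k (christoffel G k i j) y - partialDeriv j (christoffel G k k i) y)
    + ∑ k, ∑ l, (christoffel G k k l y * christoffel G l i j y
        - christoffel G k j l y * christoffel G l k i y)

/-- The Hessian components `∇²_ij f = ∂_i ∂_j f - ∑_k Γ^k_ij ∂_k f`. -/
def hessian (G : EuclideanSpace ℝ (Fin n) → Matrix (Fin n) (Fin n) ℝ)
    (f : EuclideanSpace ℝ (Fin n) → ℝ) (i j : Fin n) (y : EuclideanSpace ℝ (Fin n)) : ℝ :=
  partialDeriv i (partialDeriv j f) y - ∑ k, christoffel G k i j y * partialDeriv k f y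

/-- The Laplacian `∑_ij G^ij ∇²_ij f`, the trace of the Hessian. -/
def laplacian (G : EuclideanSpace ℝ (Fin n) → Matrix (Fin n) (Fin n) ℝ)
    (f : EuclideanSpace ℝ (Fin n) → ℝ) (y : EuclideanSpace ℝ (Fin n)) : ℝ :=
  ∑ i, ∑ j, (G y)⁻¹ i j * hessian G f i j y

end LocalGeometry

namespace SmoothMetric

variable {n : ℕ} {M : Type*} [TopologicalSpace M]
  [ChartedSpace (EuclideanSpace ℝ (Fin n)) M] [IsManifold (𝓡 n) ∞ M]

/-- The coordinate vector field `∂/∂x_i` of the chart `extChartAt p`, at the point of `M` with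
coordinates `y`. -/
def coordVec (p : M) (y : EuclideanSpace ℝ (Fin n)) (i : Fin n) :
    TangentSpace (𝓡 n) ((extChartAt (𝓡 n) p).symm y) :=
  mfderiv 𝓘(ℝ, EuclideanSpace ℝ (Fin n)) (𝓡 n) (extChartAt (𝓡 n) p).symm y
    (EuclideanSpace.single i (1 : ℝ) : EuclideanSpace ℝ (Fin n))

/-- The components `G_ij` of the metric in the chart around `p`, as functions of the
coordinates. -/
def inChart (m : SmoothMetric n M) (p : M) (y : EuclideanSpace ℝ (Fin n)) :
    Matrix (Fin n) (Fin n) ℝ :=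
  Matrix.of fun i j ↦
    m.inner ((extChartAt (𝓡 n) p).symm y) (coordVec p y i) (coordVec p y j)

/-- The components of a tangent vector at `p` in the coordinate basis of the chart around `p`. -/
def vecCoord (p : M) (v : TangentSpace (𝓡 n) p) : EuclideanSpace ℝ (Fin n) :=
  mfderiv (𝓡 n) 𝓘(ℝ, EuclideanSpace ℝ (Fin n)) (extChartAt (𝓡 n) p) p v

/-- The Ricci tensor at `p`, computed in the chart around `p`. -/
def ricci (m : SmoothMetric n M) (p : M) (v w : TangentSpace (𝓡 n) p) : ℝ :=
  ∑ i, ∑ j, LocalGeometry.ricci (m.inChart p) i j (extChartAt (𝓡 n) p p)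
    * vecCoord p v i * vecCoord p w j

/-- `Ric ≥ K`: the Ricci curvature is bounded below by `K`. -/
def RicciBoundedBelow (m : SmoothMetric n M) (K : ℝ) : Prop :=
  ∀ (p : M) (v : TangentSpace (𝓡 n) p), K * m.inner p v v ≤ m.ricci p v v

/-- The Laplace-Beltrami operator `Δ u = div ∇u = tr ∇²u` at `p`, computed in the chart
around `p`. -/
def laplacian (m : SmoothMetric n M) (u : M → ℝ) (p : M) : ℝ :=
  LocalGeometry.laplacian (m.inChart p) (u ∘ (extChartAt (𝓡 n) p).symm) (extChartAt (𝓡 n) p p)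

end SmoothMetric

end

/-! The proof is a Bochner argument weighted by u itself. Write K = (n-1)κ. For smooth f, the
Bochner formula and the Cauchy–Schwarz bound (Δf)² ≤ n |∇²f|² turn Ric ≥ K into the
curvature-dimension inequality (Δf)²/n + K|∇f|² ≤ ½Δ|∇f|² - ⟨∇f, ∇Δf⟩. Multiply by a weight w ≥ 0,
integrate, and move derivatives by Green's formula: ½wΔ|∇f|² becomes ½|∇f|²Δw, and -w⟨∇f, ∇Δf⟩
becomes Δf⟨∇f, ∇w⟩ + w(Δf)². The resulting inequality, 0 ≤ ∫ `bochnerTerm`, contains only two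
derivatives of f, so it survives approximation and holds for f of class C². This matters because g
is only continuous and u only C².

Now take f = w = u and substitute Δu = -g(u). With G(t) = ∫₀ᵗ g, the vanishing of the integrals of
Δ(∫₀ᵘ G) and of Δ(u³/6) gives ∫ g(u)|∇u|² = ∫ g(u)G(u) and ∫ u|∇u|² = ½∫ u²g(u). All gradients
disappear, and twice the inequality says that g(u)(2(n-1)u g(u)/n - 3G(u) - K u²) has non-negative
integral (`volIntegral_nonneg_of_solution`). By hypothesis this continuous function is ≤ 0, so it
vanishes identically and u takes its values in S. Since S is discrete, M connected and u continuous,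
u is constant.

Geometry is done in coordinates. The inequality is linear in w, so a partition of unity reduces it
to weights supported in one chart, where integration by parts is that of ℝⁿ for the density √det G.
The Laplacian and the Ricci tensor at a point are defined in the preferred chart of that point, so
coordinate invariance has to be proved: `christoffel_comp` gives it for the Laplacian. Polarizing
Δ(fh) gives it for ⟨∇f, ∇h⟩, and iterating gives it for ½Δ|∇f|² - ⟨∇f, ∇Δf⟩ (`curvatureTerm_comp`).
The curvature-dimension inequality can thus be carried from the preferred chart to any other without
a transformation law for the Ricci tensor. -/

/-- The Euclidean model space. -/
abbrev Euc (n : ℕ) := EuclideanSpace ℝ (Fin n)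

namespace LocalGeometry

open Filter Topology Matrix

variable {n : ℕ}

/-! ### Partial derivatives -/

section PartialDeriv

variable {f h : Euc n → ℝ} {y : Euc n}

lemma partialDeriv_congr (i : Fin n) (e : f =ᶠ[𝓝 y] h) :
    partialDeriv i f y = partialDeriv i h y := by
  unfold partialDeriv; rw [e.fderiv_eq]

lemma partialDeriv_eventuallyEq (i : Fin n) (e : f =ᶠ[𝓝 y] h) :
    partialDeriv i f =ᶠ[𝓝 y] partialDeriv i h :=
  e.eventuallyEq_nhds.mono fun _ hz ↦ partialDeriv_congr i hz

lemma partialDeriv_const (i : Fin n) (c : ℝ) : partialDeriv i (fun _ : Euc n ↦ c) y = 0 := by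
  simp [partialDeriv]

lemma partialDeriv_add (i : Fin n) (hf : DifferentiableAt ℝ f y) (hh : DifferentiableAt ℝ h y) :
    partialDeriv i (fun z ↦ f z + h z) y = partialDeriv i f y + partialDeriv i h y := by
  unfold partialDeriv; rw [fderiv_fun_add hf hh]; rfl

lemma partialDeriv_mul (i : Fin n) (hf : DifferentiableAt ℝ f y) (hh : DifferentiableAt ℝ h y) :
    partialDeriv i (fun z ↦ f z * h z) y
      = partialDeriv i f y * h y + f y * partialDeriv i h y := by
  unfold partialDeriv; rw [fderiv_fun_mul hf hh]
  simp; ring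

lemma partialDeriv_const_mul (i : Fin n) (c : ℝ) (hf : DifferentiableAt ℝ f y) :
    partialDeriv i (fun z ↦ c * f z) y = c * partialDeriv i f y := by
  unfold partialDeriv; rw [fderiv_const_mul hf]; simp

lemma partialDeriv_sum {ι : Type*} (s : Finset ι) (i : Fin n) {F : ι → Euc n → ℝ}
    (hF : ∀ a ∈ s, DifferentiableAt ℝ (F a) y) :
    partialDeriv i (fun z ↦ ∑ a ∈ s, F a z) y = ∑ a ∈ s, partialDeriv i (F a) y := by
  unfold partialDeriv; rw [fderiv_fun_sum hF]; simp

lemma partialDeriv_comp (i : Fin n) {H : ℝ → ℝ} {H' : ℝ} (hH : HasDerivAt H H' (f y))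
    (hf : DifferentiableAt ℝ f y) :
    partialDeriv i (fun z ↦ H (f z)) y = H' * partialDeriv i f y := by
  unfold partialDeriv
  have := (hH.comp_hasFDerivAt y hf.hasFDerivAt).fderiv
  simp only [Function.comp_def] at this
  rw [this]; simp

lemma fderiv_apply_eq_sum (v : Euc n) :
    fderiv ℝ f y v = ∑ i, partialDeriv i f y * v i := by
  conv_lhs => rw [← (EuclideanSpace.basisFun (Fin n) ℝ).sum_repr v]
  simp [partialDeriv, mul_comm]

lemma contDiffAt_partialDeriv {m k : WithTop ℕ∞} (hf : ContDiffAt ℝ k f y) (hmk : m + 1 ≤ k)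
    (i : Fin n) : ContDiffAt ℝ m (partialDeriv i f) y :=
  (hf.fderiv_right hmk).clm_apply contDiffAt_const

lemma partialDeriv_comm (hf : ContDiffAt ℝ 2 f y) (i j : Fin n) :
    partialDeriv i (partialDeriv j f) y = partialDeriv j (partialDeriv i f) y := by
  have hd : DifferentiableAt ℝ (fderiv ℝ f) y :=
    (hf.fderiv_right (m := 1) (by norm_num)).differentiableAt (by norm_num)
  have key (i j : Fin n) : partialDeriv i (partialDeriv j f) y
      = fderiv ℝ (fderiv ℝ f) y (EuclideanSpace.single i 1) (EuclideanSpace.single j 1) := by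
    change fderiv ℝ (fun z ↦ fderiv ℝ f z (EuclideanSpace.single j 1)) y _ = _
    rw [fderiv_clm_apply hd (differentiableAt_const _)]
    simp
  rw [key, key]
  exact (hf.isSymmSndFDerivAt (by simp)).eq _ _

end PartialDeriv

/-! ### Smoothness of determinants and inverses of matrix fields -/

section MatrixCalculus

variable {ι : Type*} [Fintype ι] [DecidableEq ι] {A : Euc n → Matrix ι ι ℝ} {y : Euc n}
  {k : WithTop ℕ∞}

lemma contDiffAt_det (hA : ∀ i j, ContDiffAt ℝ k (fun z ↦ A z i j) y) :
    ContDiffAt ℝ k (fun z ↦ (A z).det) y := by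
  simp only [Matrix.det_apply]
  exact ContDiffAt.sum fun σ _ ↦ (contDiffAt_prod fun i _ ↦ hA _ _).const_smul _

lemma contDiffAt_inv (hA : ∀ i j, ContDiffAt ℝ k (fun z ↦ A z i j) y)
    (h0 : (A y).det ≠ 0) (i j : ι) : ContDiffAt ℝ k (fun z ↦ (A z)⁻¹ i j) y := by
  simp only [Matrix.inv_def, Ring.inverse_eq_inv', Matrix.smul_apply, Matrix.adjugate_apply,
    smul_eq_mul]
  refine ((contDiffAt_det hA).inv h0).mul (contDiffAt_det fun a b ↦ ?_)
  by_cases h : a = j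
  · subst h; simpa using contDiffAt_const
  · simpa [Matrix.updateRow_ne h] using hA a b

/-- Jacobi's formula for the derivative of a determinant. -/
lemma partialDeriv_det (hA : ∀ i j, DifferentiableAt ℝ (fun z ↦ A z i j) y) (l : Fin n) :
    partialDeriv l (fun z ↦ (A z).det) y
      = ((A y).adjugate * Matrix.of fun i j ↦ partialDeriv l (fun z ↦ A z i j) y).trace := by
  -- The determinant is a continuous multilinear function of the rows, so its derivative is the sum
  -- over i of the determinants with row i differentiated. Cramer's rule then identifies these with
  -- entries of the adjugate times the derivative.
  let D : ContinuousMultilinearMap ℝ (fun _ : ι ↦ ι → ℝ) ℝ :=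
    { toMultilinearMap := (Matrix.detRowAlternating (R := ℝ) (n := ι)).toMultilinearMap
      cont := by
        change Continuous fun M : ι → ι → ℝ ↦ Matrix.det (Matrix.of M)
        exact Continuous.matrix_det (A := fun M : ι → ι → ℝ ↦ Matrix.of M) continuous_id }
  have hAd : HasFDerivAt (fun z ↦ (A z : ι → ι → ℝ))
      (ContinuousLinearMap.pi fun i ↦ ContinuousLinearMap.pi fun j ↦
        fderiv ℝ (fun z ↦ A z i j) y) y :=
    hasFDerivAt_pi.2 fun i ↦ hasFDerivAt_pi.2 fun j ↦ (hA i j).hasFDerivAt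
  have hc := (D.hasFDerivAt (A y)).comp y hAd
  have : partialDeriv l (fun z ↦ (A z).det) y = D.linearDeriv (A y)
      (fun i j ↦ partialDeriv l (fun z ↦ A z i j) y) := by
    unfold partialDeriv
    rw [show (fun z ↦ (A z).det) = (D ∘ fun z ↦ (A z : ι → ι → ℝ)) from rfl, hc.fderiv]
    rfl
  refine this.trans ((ContinuousMultilinearMap.linearDeriv_apply D _ _).trans ?_)
  rw [Matrix.trace_mul_comm]
  simp only [Matrix.trace, Matrix.diag, Matrix.mul_apply, Matrix.of_apply]
  refine Finset.sum_congr rfl fun i _ ↦ ?_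
  change ((A y).updateRow i fun j ↦ partialDeriv l (fun z ↦ A z i j) y).det = _
  rw [← Matrix.cramer_transpose_apply, Matrix.cramer_eq_adjugate_mulVec, ← Matrix.adjugate_transpose]
  simp only [Matrix.mulVec, dotProduct, Matrix.transpose_apply]
  exact Finset.sum_congr rfl fun j _ ↦ mul_comm _ _

end MatrixCalculus

end LocalGeometry

namespace LocalGeometry

open Filter Topology Matrix

variable {n : ℕ}

/-! ### Riemannian metrics on open subsets of `ℝⁿ` -/

/-- `G` is the matrix field of a smooth Riemannian metric on the open set `U`. -/
structure IsMetricOn (G : Euc n → Matrix (Fin n) (Fin n) ℝ) (U : Set (Euc n)) : Prop where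
  isOpen : IsOpen U
  contDiffAt : ∀ y ∈ U, ∀ i j, ContDiffAt ℝ ∞ (fun z ↦ G z i j) y
  posDef : ∀ y ∈ U, (G y).PosDef

/-- The matrix `(∂_k G_ij)_ij`. -/
noncomputable def derivMatrix (G : Euc n → Matrix (Fin n) (Fin n) ℝ) (k : Fin n) (y : Euc n) :
    Matrix (Fin n) (Fin n) ℝ :=
  Matrix.of fun i j ↦ partialDeriv k (fun z ↦ G z i j) y

/-- The connection matrix `(Γ^m_ki)_mi`. -/
noncomputable def connMatrix (G : Euc n → Matrix (Fin n) (Fin n) ℝ) (k : Fin n) (y : Euc n) :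
    Matrix (Fin n) (Fin n) ℝ :=
  Matrix.of fun m i ↦ christoffel G m k i y

/-- The Riemannian volume density `√(det G)`. -/
noncomputable def volDensity (G : Euc n → Matrix (Fin n) (Fin n) ℝ) (y : Euc n) : ℝ := √(G y).det

/-- The gradient vector field `F^i = ∑_j G^ij ∂_j f`. -/
noncomputable def grad (G : Euc n → Matrix (Fin n) (Fin n) ℝ) (f : Euc n → ℝ) (i : Fin n) (y : Euc n) : ℝ :=
  ∑ j, (G y)⁻¹ i j * partialDeriv j f y

/-- The inner product `⟨∇f, ∇h⟩ = ∑_ij G^ij ∂_i f ∂_j h`. -/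
noncomputable def gradInner (G : Euc n → Matrix (Fin n) (Fin n) ℝ) (f h : Euc n → ℝ) (y : Euc n) : ℝ :=
  ∑ i, partialDeriv i f y * grad G h i y

namespace IsMetricOn

variable {G : Euc n → Matrix (Fin n) (Fin n) ℝ} {U : Set (Euc n)} (hG : IsMetricOn G U)
  {y : Euc n} (hy : y ∈ U)

include hG hy

lemma det_pos : 0 < (G y).det := (hG.posDef y hy).det_pos

lemma isUnit_det : IsUnit (G y).det := (hG.det_pos hy).ne'.isUnit

lemma mem_nhds : U ∈ 𝓝 y := hG.isOpen.mem_nhds hy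

lemma mul_inv : G y * (G y)⁻¹ = 1 := Matrix.mul_nonsing_inv _ (hG.isUnit_det hy)

lemma inv_mul : (G y)⁻¹ * G y = 1 := Matrix.nonsing_inv_mul _ (hG.isUnit_det hy)

lemma symm (i j : Fin n) : G y i j = G y j i := by
  simpa using ((hG.posDef y hy).isHermitian.apply i j).symm

lemma transpose_eq : (G y)ᵀ = G y := by
  ext i j; exact hG.symm hy j i

lemma inv_transpose : ((G y)⁻¹)ᵀ = (G y)⁻¹ := by
  rw [Matrix.transpose_nonsing_inv, hG.transpose_eq hy]

lemma inv_symm (i j : Fin n) : (G y)⁻¹ i j = (G y)⁻¹ j i :=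
  congrFun (congrFun (hG.inv_transpose hy) j) i

lemma contDiffAt_inv (i j : Fin n) : ContDiffAt ℝ ∞ (fun z ↦ (G z)⁻¹ i j) y :=
  LocalGeometry.contDiffAt_inv (hG.contDiffAt y hy) (hG.det_pos hy).ne' i j

lemma differentiableAt (i j : Fin n) : DifferentiableAt ℝ (fun z ↦ G z i j) y :=
  (hG.contDiffAt y hy i j).differentiableAt (by simp)

lemma differentiableAt_inv (i j : Fin n) : DifferentiableAt ℝ (fun z ↦ (G z)⁻¹ i j) y :=
  (hG.contDiffAt_inv hy i j).differentiableAt (by simp)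

lemma contDiffAt_christoffel (k i j : Fin n) : ContDiffAt ℝ ∞ (christoffel G k i j) y := by
  have h (a b c : Fin n) : ContDiffAt ℝ ∞ (partialDeriv a fun z ↦ G z b c) y :=
    contDiffAt_partialDeriv (hG.contDiffAt y hy b c) (by simp) a
  exact contDiffAt_const.mul (ContDiffAt.sum fun l _ ↦
    (hG.contDiffAt_inv hy k l).mul (((h i j l).add (h j i l)).sub (h l i j)))

lemma contDiffAt_volDensity : ContDiffAt ℝ ∞ (volDensity G) y :=
  (contDiffAt_det (hG.contDiffAt y hy)).sqrt (hG.det_pos hy).ne'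

lemma volDensity_pos : 0 < volDensity G y := Real.sqrt_pos.2 (hG.det_pos hy)

lemma derivMatrix_symm (k i j : Fin n) : derivMatrix G k y i j = derivMatrix G k y j i := by
  refine partialDeriv_congr k ?_
  filter_upwards [hG.mem_nhds hy] with z hz using hG.symm hz i j

lemma christoffel_symm (k i j : Fin n) : christoffel G k i j y = christoffel G k j i y := by
  unfold christoffel
  congr 1
  refine Finset.sum_congr rfl fun l _ ↦ ?_
  have := hG.derivMatrix_symm hy l i j
  simp only [derivMatrix, Matrix.of_apply] at this
  rw [this]; ring

/-- Lowering the upper index of the Christoffel symbols. -/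
lemma sum_mul_christoffel (l i j : Fin n) :
    ∑ m, G y l m * christoffel G m i j y = (1 / 2) * (derivMatrix G i y j l
      + derivMatrix G j y i l - derivMatrix G l y i j) := by
  have h : ∀ v : Fin n → ℝ, (G y *ᵥ ((G y)⁻¹ *ᵥ v)) = v := fun v ↦ by
    rw [Matrix.mulVec_mulVec, hG.mul_inv hy, Matrix.one_mulVec]
  have := congrFun (h fun l ↦ derivMatrix G i y j l
      + derivMatrix G j y i l - derivMatrix G l y i j) l
  rw [← this]
  simp only [Matrix.mulVec, dotProduct, christoffel, derivMatrix, Matrix.of_apply, Finset.mul_sum]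
  refine Finset.sum_congr rfl fun m _ ↦ Finset.sum_congr rfl fun p _ ↦ by ring

/-- The Levi-Civita connection is compatible with the metric. -/
lemma derivMatrix_eq (k : Fin n) :
    derivMatrix G k y = G y * connMatrix G k y + (connMatrix G k y)ᵀ * G y := by
  ext i j
  have h1 : (G y * connMatrix G k y) i j = _ := hG.sum_mul_christoffel hy i k j
  have h2 : ((connMatrix G k y)ᵀ * G y) i j = ∑ m, G y j m * christoffel G m k i y := by
    simp only [Matrix.mul_apply, Matrix.transpose_apply, connMatrix, Matrix.of_apply]
    exact Finset.sum_congr rfl fun m _ ↦ by rw [hG.symm hy m j, mul_comm]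
  rw [Matrix.add_apply, h1, h2, hG.sum_mul_christoffel hy, hG.derivMatrix_symm hy k j i]
  ring

/-- The derivative of the inverse metric. -/
lemma derivMatrix_inv (k : Fin n) :
    derivMatrix (fun z ↦ (G z)⁻¹) k y
      = -(connMatrix G k y * (G y)⁻¹) - (G y)⁻¹ * (connMatrix G k y)ᵀ := by
  -- Differentiate G G⁻¹ = 1, which holds on a whole neighbourhood of y.
  have h0 : derivMatrix G k y * (G y)⁻¹ + G y * derivMatrix (fun z ↦ (G z)⁻¹) k y = 0 := by
    ext i j
    have e : (fun z ↦ ∑ l, G z i l * (G z)⁻¹ l j) =ᶠ[𝓝 y]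
        fun _ ↦ (1 : Matrix (Fin n) (Fin n) ℝ) i j := by
      filter_upwards [hG.mem_nhds hy] with z hz
      exact congrFun (congrFun (hG.mul_inv hz) i) j
    have e1 := partialDeriv_congr k e
    rw [partialDeriv_const, partialDeriv_sum _ _ fun l _ ↦
      (hG.differentiableAt hy i l).fun_mul (hG.differentiableAt_inv hy l j)] at e1
    simp only [Matrix.add_apply, Matrix.mul_apply, Matrix.zero_apply, ← Finset.sum_add_distrib]
    rw [← e1]
    exact Finset.sum_congr rfl fun l _ ↦
      (partialDeriv_mul k (hG.differentiableAt hy i l) (hG.differentiableAt_inv hy l j)).symm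
  have h1 : derivMatrix (fun z ↦ (G z)⁻¹) k y
      = -((G y)⁻¹ * (derivMatrix G k y * (G y)⁻¹)) := by
    rw [eq_neg_iff_add_eq_zero, add_comm]
    have := congrArg (fun X ↦ (G y)⁻¹ * X) h0
    simpa [Matrix.mul_add, ← Matrix.mul_assoc, hG.inv_mul hy] using this
  rw [h1, hG.derivMatrix_eq hy]
  have e2 : (G y)⁻¹ * ((G y * connMatrix G k y + (connMatrix G k y)ᵀ * G y) * (G y)⁻¹)
      = ((G y)⁻¹ * G y) * connMatrix G k y * (G y)⁻¹
        + (G y)⁻¹ * (connMatrix G k y)ᵀ * (G y * (G y)⁻¹) := by noncomm_ring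
  rw [e2, hG.inv_mul hy, hG.mul_inv hy]
  noncomm_ring

lemma partialDeriv_inv (k i j : Fin n) :
    partialDeriv k (fun z ↦ (G z)⁻¹ i j) y
      = -(∑ m, christoffel G i k m y * (G y)⁻¹ m j)
        - ∑ m, (G y)⁻¹ i m * christoffel G j k m y :=
  congrFun (congrFun (hG.derivMatrix_inv hy k) i) j

/-- The derivative of the volume density. -/
lemma partialDeriv_volDensity (k : Fin n) :
    partialDeriv k (volDensity G) y = volDensity G y * ∑ l, christoffel G l l k y := by
  have hd : partialDeriv k (fun z ↦ (G z).det) y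
      = 2 * (G y).det * ∑ l, christoffel G l l k y := by
    have ht : (connMatrix G k y).trace = ∑ l, christoffel G l l k y :=
      Finset.sum_congr rfl fun l _ ↦ hG.christoffel_symm hy l k l
    rw [partialDeriv_det (hG.differentiableAt hy)]
    change ((G y).adjugate * derivMatrix G k y).trace = _
    -- By metric compatibility ∂G = GΓ + ΓᵀG. Since adj(G) G = G adj(G) = det G, each summand
    -- contributes det G · tr Γ, whence the factor 2, which the square root halves again.
    rw [hG.derivMatrix_eq hy, Matrix.mul_add, Matrix.trace_add, ← Matrix.mul_assoc,
      Matrix.adjugate_mul, Matrix.trace_mul_comm (G y).adjugate, Matrix.mul_assoc,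
      Matrix.mul_adjugate]
    simp [ht]
    ring
  unfold volDensity
  rw [partialDeriv_comp k (Real.hasDerivAt_sqrt (hG.det_pos hy).ne')
    ((contDiffAt_det (hG.contDiffAt y hy)).differentiableAt (by simp)), hd]
  have hs := Real.mul_self_sqrt (hG.det_pos hy).le
  have hp := Real.sqrt_pos.2 (hG.det_pos hy)
  field_simp
  rw [sq, hs]

end IsMetricOn

end LocalGeometry

/-! ### Divergence, Hessian and the Bochner formula. -/

namespace LocalGeometry

open Filter Topology Matrix

variable {n : ℕ}

/-- The divergence `∑_k ∂_k X^k + ∑_kl Γ^k_kl X^l` of a vector field. -/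
noncomputable def divergence (G : Euc n → Matrix (Fin n) (Fin n) ℝ) (X : Fin n → Euc n → ℝ)
    (y : Euc n) : ℝ :=
  ∑ k, partialDeriv k (X k) y + ∑ k, ∑ l, christoffel G k k l y * X l y

/-- The identity between finite sums behind the Bochner formula. -/
lemma bochner_sum_identity {ι : Type*} [Fintype ι] (F : ι → ℝ) (dF : ι → ι → ℝ)
    (ddF : ι → ι → ι → ℝ) (Γ : ι → ι → ι → ℝ) (dΓ : ι → ι → ι → ι → ℝ)
    (hdd : ∀ i j k, ddF i j k = ddF j i k) (hΓ : ∀ k i j, Γ k i j = Γ k j i) :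
    (∑ k, ∑ i, (dF k i * (dF i k + ∑ p, Γ k i p * F p)
        + F i * (ddF k i k + ∑ p, (dΓ k k i p * F p + Γ k i p * dF k p)))
      + ∑ k, ∑ l, Γ k k l * ∑ i, F i * (dF i l + ∑ p, Γ l i p * F p))
      - ∑ i, F i * (∑ k, ddF i k k + ∑ k, ∑ l, (dΓ i k k l * F l + Γ k k l * dF i l))
    = ∑ k, ∑ i, (dF k i + ∑ p, Γ i k p * F p) * (dF i k + ∑ p, Γ k i p * F p)
      + ∑ i, ∑ p, (∑ k, (dΓ k k i p - dΓ p k k i)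
        + ∑ k, ∑ l, (Γ k k l * Γ l i p - Γ k p l * Γ l k i)) * F i * F p := by
  -- Here F is the gradient field and dF, ddF, dΓ are its derivatives and those of Γ. Each of
  -- `e1`–`e7` only renames summation indices; the actual inputs are the commutation of second
  -- derivatives in `e2`, which removes the derivatives of highest order, and the symmetry of Γ in
  -- `e1` and `e7`.
  have e1 : ∑ k, ∑ i, ∑ p, F i * (Γ k i p * dF k p) = ∑ k, ∑ i, ∑ p, Γ i k p * F p * dF i k := by
    rw [Finset.sum_comm]
    rw [Finset.sum_congr rfl fun i _ ↦ Finset.sum_comm, Finset.sum_comm]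
    refine Finset.sum_congr rfl fun k _ ↦ ?_
    rw [Finset.sum_comm]
    refine Finset.sum_congr rfl fun i _ ↦ Finset.sum_congr rfl fun p _ ↦ ?_
    rw [hΓ i k p]; ring
  have e2 : ∑ k, ∑ i, F i * ddF k i k = ∑ i, ∑ k, F i * ddF i k k := by
    rw [Finset.sum_comm]
    exact Finset.sum_congr rfl fun i _ ↦ Finset.sum_congr rfl fun k _ ↦ by rw [hdd]
  have e3 : ∑ k, ∑ i, ∑ p, F i * (dΓ k k i p * F p) = ∑ i, ∑ p, ∑ k, dΓ k k i p * F i * F p := by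
    rw [Finset.sum_comm]
    refine Finset.sum_congr rfl fun i _ ↦ ?_
    rw [Finset.sum_comm]
    exact Finset.sum_congr rfl fun p _ ↦ Finset.sum_congr rfl fun k _ ↦ by ring
  have e4 : ∑ k, ∑ l, ∑ i, Γ k k l * (F i * dF i l) = ∑ i, ∑ k, ∑ l, F i * (Γ k k l * dF i l) := by
    rw [Finset.sum_congr rfl fun k _ ↦ Finset.sum_comm, Finset.sum_comm]
    exact Finset.sum_congr rfl fun i _ ↦ Finset.sum_congr rfl fun k _ ↦
      Finset.sum_congr rfl fun l _ ↦ by ring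
  have e5 : ∑ k, ∑ l, ∑ i, ∑ p, Γ k k l * (F i * (Γ l i p * F p))
      = ∑ i, ∑ p, ∑ k, ∑ l, Γ k k l * Γ l i p * F i * F p := by
    rw [Finset.sum_congr rfl fun k _ ↦ Finset.sum_comm, Finset.sum_comm]
    refine Finset.sum_congr rfl fun i _ ↦ ?_
    rw [Finset.sum_congr rfl fun k _ ↦ Finset.sum_comm, Finset.sum_comm]
    exact Finset.sum_congr rfl fun p _ ↦ Finset.sum_congr rfl fun k _ ↦
      Finset.sum_congr rfl fun l _ ↦ by ring
  have e6 : ∑ i, ∑ k, ∑ l, F i * (dΓ i k k l * F l)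
      = ∑ i, ∑ p, ∑ k, dΓ p k k i * F i * F p := by
    rw [Finset.sum_congr rfl fun k _ ↦ Finset.sum_comm, Finset.sum_comm]
    exact Finset.sum_congr rfl fun p _ ↦ Finset.sum_congr rfl fun k _ ↦
      Finset.sum_congr rfl fun l _ ↦ by ring
  have e7 : ∑ k, ∑ i, ∑ q, ∑ p, Γ i k p * F p * (Γ k i q * F q)
      = ∑ i, ∑ p, ∑ k, ∑ l, Γ k p l * Γ l k i * F i * F p := by
    have : ∀ k i, ∑ q, ∑ p, Γ i k p * F p * (Γ k i q * F q)
        = ∑ q, ∑ p, Γ i p k * Γ k i q * F q * F p := fun k i ↦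
      Finset.sum_congr rfl fun p _ ↦ Finset.sum_congr rfl fun q _ ↦ by rw [hΓ i k]; ring
    rw [Finset.sum_comm]
    simp only [this]
    rw [Finset.sum_congr rfl fun i _ ↦ Finset.sum_comm, Finset.sum_comm]
    refine Finset.sum_congr rfl fun q _ ↦ ?_
    rw [Finset.sum_congr rfl fun i _ ↦ Finset.sum_comm, Finset.sum_comm]
  simp only [mul_add, add_mul, sub_mul, Finset.sum_add_distrib, Finset.sum_sub_distrib,
    Finset.mul_sum, Finset.sum_mul]
  rw [e1, e2, e3, e4, e5, e6, e7]
  ring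

namespace IsMetricOn

variable {G : Euc n → Matrix (Fin n) (Fin n) ℝ} {U : Set (Euc n)} (hG : IsMetricOn G U)
  {y : Euc n} (hy : y ∈ U) {f h : Euc n → ℝ}

include hG hy

lemma contDiffAt_grad {m k : WithTop ℕ∞} (hf : ContDiffAt ℝ k f y) (hmk : m + 1 ≤ k)
    (hm : m ≤ ∞) (i : Fin n) : ContDiffAt ℝ m (grad G f i) y :=
  ContDiffAt.sum fun j _ ↦
    ((hG.contDiffAt_inv hy i j).of_le hm).mul (contDiffAt_partialDeriv hf hmk j)

lemma contDiffAt_gradInner {m k : WithTop ℕ∞} (hf : ContDiffAt ℝ k f y) (hh : ContDiffAt ℝ k h y)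
    (hmk : m + 1 ≤ k) (hm : m ≤ ∞) : ContDiffAt ℝ m (gradInner G f h) y :=
  ContDiffAt.sum fun i _ ↦
    (contDiffAt_partialDeriv hf hmk i).mul (hG.contDiffAt_grad hy hh hmk hm i)

lemma contDiffAt_laplacian {m k : WithTop ℕ∞} (hf : ContDiffAt ℝ k f y)
    (hmk : m + 1 + 1 ≤ k) (hm : m ≤ ∞) : ContDiffAt ℝ m (laplacian G f) y := by
  have h1 : m + 1 ≤ k := le_trans (by gcongr; exact le_self_add) hmk
  exact ContDiffAt.sum fun i _ ↦ ContDiffAt.sum fun j _ ↦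
    ((hG.contDiffAt_inv hy i j).of_le hm).mul
      ((contDiffAt_partialDeriv (contDiffAt_partialDeriv hf hmk j) le_rfl i).sub
        (ContDiffAt.sum fun l _ ↦ ((hG.contDiffAt_christoffel hy l i j).of_le hm).mul
          (contDiffAt_partialDeriv hf h1 l)))

lemma hessian_symm (hf : ContDiffAt ℝ 2 f y) (i j : Fin n) :
    hessian G f i j y = hessian G f j i y := by
  unfold hessian
  rw [partialDeriv_comm hf]
  simp only [hG.christoffel_symm hy _ i j]

lemma gradInner_eq_sum_grad : gradInner G f h y = ∑ i, grad G f i y * partialDeriv i h y := by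
  simp only [gradInner, grad, Finset.mul_sum, Finset.sum_mul]
  rw [Finset.sum_comm]
  refine Finset.sum_congr rfl fun i _ ↦ Finset.sum_congr rfl fun j _ ↦ ?_
  rw [hG.inv_symm hy i j]; ring

lemma gradInner_comm : gradInner G f h y = gradInner G h f y := by
  rw [hG.gradInner_eq_sum_grad hy]
  exact Finset.sum_congr rfl fun i _ ↦ mul_comm _ _

/-- The covariant derivative of the gradient is the Hessian. -/
lemma partialDeriv_grad (hf : ContDiffAt ℝ 2 f y) (i k : Fin n) :
    partialDeriv i (grad G f k) y
      = ∑ j, (G y)⁻¹ k j * hessian G f i j y - ∑ m, christoffel G k i m y * grad G f m y := by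
  have hd (j : Fin n) : DifferentiableAt ℝ (partialDeriv j f) y :=
    (contDiffAt_partialDeriv (m := 1) hf (by norm_num) j).differentiableAt (by norm_num)
  unfold grad
  rw [partialDeriv_sum _ _ fun j _ ↦ (hG.differentiableAt_inv hy k j).fun_mul (hd j),
    Finset.sum_congr rfl fun j _ ↦ partialDeriv_mul i (hG.differentiableAt_inv hy k j) (hd j)]
  simp only [hG.partialDeriv_inv hy, hessian, mul_sub, sub_mul, neg_mul, Finset.sum_add_distrib,
    Finset.sum_sub_distrib, Finset.mul_sum, Finset.sum_mul, Finset.sum_neg_distrib]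
  have e1 : ∑ j, ∑ m, christoffel G k i m y * (G y)⁻¹ m j * partialDeriv j f y
      = ∑ m, ∑ j, christoffel G k i m y * ((G y)⁻¹ m j * partialDeriv j f y) := by
    rw [Finset.sum_comm]; simp only [mul_assoc]
  have e2 : ∑ j, ∑ m, (G y)⁻¹ k m * christoffel G j i m y * partialDeriv j f y
      = ∑ m, ∑ j, (G y)⁻¹ k m * (christoffel G j i m y * partialDeriv j f y) := by
    rw [Finset.sum_comm]; simp only [mul_assoc]
  rw [e1, e2]; ring

/-- The Laplacian is the divergence of the gradient. -/
lemma laplacian_eq_divergence (hf : ContDiffAt ℝ 2 f y) :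
    laplacian G f y = divergence G (grad G f) y := by
  unfold laplacian divergence
  simp only [hG.partialDeriv_grad hy hf, Finset.sum_sub_distrib]
  ring

/-- Metric compatibility of the connection: the Christoffel terms from differentiating ∂f and from
differentiating ∇f combine into a second copy of the Hessian, whence the factor 2. -/
lemma partialDeriv_gradInner_self (hf : ContDiffAt ℝ 2 f y) (k : Fin n) :
    partialDeriv k (gradInner G f f) y = 2 * ∑ i, hessian G f k i y * grad G f i y := by
  have hd (j : Fin n) : DifferentiableAt ℝ (partialDeriv j f) y :=
    (contDiffAt_partialDeriv (m := 1) hf (by norm_num) j).differentiableAt (by norm_num)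
  have hF (j : Fin n) : DifferentiableAt ℝ (grad G f j) y :=
    (hG.contDiffAt_grad (m := 1) hy hf (by norm_num) (by simp) j).differentiableAt
      (by norm_num)
  unfold gradInner
  rw [partialDeriv_sum _ _ fun j _ ↦ (hd j).fun_mul (hF j),
    Finset.sum_congr rfl fun j _ ↦ partialDeriv_mul k (hd j) (hF j), Finset.sum_add_distrib]
  simp only [hG.partialDeriv_grad hy hf, mul_sub, Finset.sum_sub_distrib]
  have e1 : ∑ i, partialDeriv i f y * ∑ j, (G y)⁻¹ i j * hessian G f k j y
      = ∑ i, hessian G f k i y * grad G f i y := by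
    simp only [grad, Finset.mul_sum]
    rw [Finset.sum_comm]
    refine Finset.sum_congr rfl fun i _ ↦ Finset.sum_congr rfl fun j _ ↦ ?_
    rw [hG.inv_symm hy i j]; ring
  have e2 : ∑ i, partialDeriv i f y * ∑ m, christoffel G i k m y * grad G f m y
      = ∑ i, (∑ m, christoffel G m k i y * partialDeriv m f y) * grad G f i y := by
    simp only [Finset.mul_sum, Finset.sum_mul]
    rw [Finset.sum_comm]
    exact Finset.sum_congr rfl fun i _ ↦ Finset.sum_congr rfl fun j _ ↦ by ring
  have e3 : ∑ i, hessian G f k i y * grad G f i y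
      = ∑ i, partialDeriv k (partialDeriv i f) y * grad G f i y
        - ∑ i, (∑ m, christoffel G m k i y * partialDeriv m f y) * grad G f i y := by
    rw [← Finset.sum_sub_distrib]
    exact Finset.sum_congr rfl fun i _ ↦ by unfold hessian; ring
  rw [e1, e2]
  linarith

/-- The vector field `∇_∇f ∇f` is half the gradient of `|∇f|²`. -/
lemma grad_gradInner_self (hf : ContDiffAt ℝ 2 f y) (k : Fin n) :
    grad G (gradInner G f f) k y = 2 * ∑ i, grad G f i y *
      (partialDeriv i (grad G f k) y + ∑ p, christoffel G k i p y * grad G f p y) := by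
  simp only [hG.partialDeriv_grad hy hf, sub_add_cancel]
  rw [grad]
  simp only [hG.partialDeriv_gradInner_self hy hf, Finset.mul_sum]
  rw [Finset.sum_comm]
  refine Finset.sum_congr rfl fun i _ ↦ Finset.sum_congr rfl fun j _ ↦ ?_
  rw [hG.hessian_symm hy hf]
  ring

omit hy in
/-- The Bochner formula. -/
lemma bochner (hy : y ∈ U) (hf : ContDiffAt ℝ 3 f y) :
    laplacian G (gradInner G f f) y / 2 - gradInner G f (laplacian G f) y
      = ∑ k, ∑ i, (∑ j, (G y)⁻¹ i j * hessian G f k j y) * (∑ j, (G y)⁻¹ k j * hessian G f i j y)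
        + ∑ i, ∑ j, ricci G i j y * grad G f i y * grad G f j y := by
  have hf2 : ContDiffAt ℝ 2 f y := hf.of_le (by norm_num)
  -- The formulas for ∇|∇f|² and Δf are about to be differentiated, so they are needed near y and
  -- not only at y.
  have hev : ∀ᶠ z in 𝓝 y, z ∈ U ∧ ContDiffAt ℝ 2 f z := by
    filter_upwards [hG.mem_nhds hy, hf2.eventually (by simp)] with z h1 h2 using ⟨h1, h2⟩
  set F := grad G f with hFdef
  have cF (k : Fin n) : ContDiffAt ℝ 2 (F k) y :=
    hG.contDiffAt_grad hy hf (by norm_num) ENat.LEInfty.out k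
  have cF1 (i k : Fin n) : ContDiffAt ℝ 1 (partialDeriv i (F k)) y :=
    contDiffAt_partialDeriv (cF k) (by norm_num) i
  have dF (k : Fin n) : DifferentiableAt ℝ (F k) y := (cF k).differentiableAt (by norm_num)
  have dF1 (i k : Fin n) : DifferentiableAt ℝ (partialDeriv i (F k)) y :=
    (cF1 i k).differentiableAt (by norm_num)
  have dΓ (k i j : Fin n) : DifferentiableAt ℝ (christoffel G k i j) y :=
    (hG.contDiffAt_christoffel hy k i j).differentiableAt (by simp)
  have dΓF (k i p : Fin n) : DifferentiableAt ℝ (fun z ↦ christoffel G k i p z * F p z) y :=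
    (dΓ k i p).fun_mul (dF p)
  have dN (i k : Fin n) : DifferentiableAt ℝ
      (fun z ↦ partialDeriv i (F k) z + ∑ p, christoffel G k i p z * F p z) y :=
    (dF1 i k).fun_add (DifferentiableAt.fun_sum fun p _ ↦ dΓF k i p)
  have hN (i k : Fin n) : ∑ j, (G y)⁻¹ k j * hessian G f i j y
      = partialDeriv i (F k) y + ∑ p, christoffel G k i p y * F p y := by
    rw [hFdef, hG.partialDeriv_grad hy hf2]; ring
  -- Δ|∇f|² is the divergence of 2 Fⁱ∇ᵢFᵏ. In this form third derivatives of f enter only through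
  -- ∂ₖ∂ᵢFᵏ, matching ∂ᵢ∂ₖFᵏ in the derivative of Δf computed in `hL`.
  have hV (k : Fin n) : partialDeriv k (grad G (gradInner G f f) k) y
      = 2 * ∑ i, (partialDeriv k (F i) y
          * (partialDeriv i (F k) y + ∑ p, christoffel G k i p y * F p y)
        + F i y * (partialDeriv k (partialDeriv i (F k)) y
          + ∑ p, (partialDeriv k (christoffel G k i p) y * F p y
            + christoffel G k i p y * partialDeriv k (F p) y))) := by
    rw [partialDeriv_congr k (h := fun z ↦ 2 * ∑ i, F i z *
      (partialDeriv i (F k) z + ∑ p, christoffel G k i p z * F p z))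
      (hev.mono fun z hz ↦ hG.grad_gradInner_self hz.1 hz.2 k),
      partialDeriv_const_mul _ _ (DifferentiableAt.fun_sum fun i _ ↦ (dF i).fun_mul (dN i k)),
      partialDeriv_sum _ _ fun i _ ↦ (dF i).fun_mul (dN i k)]
    congr 1
    refine Finset.sum_congr rfl fun i _ ↦ ?_
    rw [partialDeriv_mul k (dF i) (dN i k), partialDeriv_add k (dF1 i k)
      (DifferentiableAt.fun_sum fun p _ ↦ dΓF k i p), partialDeriv_sum _ _ fun p _ ↦ dΓF k i p]
    congr 3
    exact Finset.sum_congr rfl fun p _ ↦ partialDeriv_mul k (dΓ k i p) (dF p)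
  have hL (i : Fin n) : partialDeriv i (laplacian G f) y
      = ∑ k, partialDeriv i (partialDeriv k (F k)) y
        + ∑ k, ∑ l, (partialDeriv i (christoffel G k k l) y * F l y
          + christoffel G k k l y * partialDeriv i (F l) y) := by
    rw [partialDeriv_congr i (h := divergence G F)
      (hev.mono fun z hz ↦ hG.laplacian_eq_divergence hz.1 hz.2)]
    unfold divergence
    rw [partialDeriv_add i (DifferentiableAt.fun_sum fun k _ ↦ dF1 k k)
      (DifferentiableAt.fun_sum fun k _ ↦ DifferentiableAt.fun_sum fun l _ ↦ dΓF k k l),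
      partialDeriv_sum _ _ fun k _ ↦ dF1 k k,
      partialDeriv_sum _ _ fun k _ ↦ DifferentiableAt.fun_sum fun l _ ↦ dΓF k k l]
    congr 1
    refine Finset.sum_congr rfl fun k _ ↦ ?_
    rw [partialDeriv_sum _ _ fun l _ ↦ dΓF k k l]
    exact Finset.sum_congr rfl fun l _ ↦ partialDeriv_mul i (dΓ k k l) (dF l)
  have key := bochner_sum_identity (fun i ↦ F i y) (fun i k ↦ partialDeriv i (F k) y)
    (fun i j k ↦ partialDeriv i (partialDeriv j (F k)) y) (fun k i j ↦ christoffel G k i j y)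
    (fun l k i j ↦ partialDeriv l (christoffel G k i j) y)
    (fun i j k ↦ partialDeriv_comm (cF k) i j) (fun k i j ↦ hG.christoffel_symm hy k i j)
  have cI : ContDiffAt ℝ 2 (gradInner G f f) y :=
    hG.contDiffAt_gradInner hy hf hf (by norm_num) ENat.LEInfty.out
  rw [hG.laplacian_eq_divergence hy cI, hG.gradInner_eq_sum_grad hy]
  simp only [hN, hL, divergence, hV, hG.grad_gradInner_self hy hf2]
  simp only [ricci]
  rw [← key]
  simp only [← hFdef, mul_left_comm _ (2 : ℝ), ← Finset.mul_sum]
  ring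

end IsMetricOn

end LocalGeometry

/-! ### Jacobians, the curvature-dimension inequality and coordinate changes. -/

namespace LocalGeometry

open Filter Topology Matrix

variable {n : ℕ}

/-- The Jacobian matrix `(∂_i τ^a)_ai`. -/
noncomputable def jacobian (τ : Euc n → Euc n) (y : Euc n) : Matrix (Fin n) (Fin n) ℝ :=
  Matrix.of fun a i ↦ partialDeriv i (fun z ↦ τ z a) y

section Jacobian

variable {τ : Euc n → Euc n} {y : Euc n} {f : Euc n → ℝ}

lemma contDiffAt_apply {k : WithTop ℕ∞} (hτ : ContDiffAt ℝ k τ y) (a : Fin n) :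
    ContDiffAt ℝ k (fun z ↦ τ z a) y :=
  (EuclideanSpace.proj a : Euc n →L[ℝ] ℝ).contDiff.contDiffAt.comp y hτ

lemma fderiv_apply_eq_jacobian (hτ : DifferentiableAt ℝ τ y) (v : Euc n) (a : Fin n) :
    fderiv ℝ τ y v a = ∑ i, jacobian τ y a i * v i := by
  have h : fderiv ℝ (fun z ↦ τ z a) y v = fderiv ℝ τ y v a := by
    have := ((EuclideanSpace.proj a : Euc n →L[ℝ] ℝ).hasFDerivAt.comp y
      hτ.hasFDerivAt).fderiv
    exact congrArg (fun L : Euc n →L[ℝ] ℝ ↦ L v) this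
  rw [← h, fderiv_apply_eq_sum]
  rfl

lemma partialDeriv_comp_map (hτ : DifferentiableAt ℝ τ y) (hf : DifferentiableAt ℝ f (τ y))
    (i : Fin n) : partialDeriv i (fun z ↦ f (τ z)) y
      = ∑ b, partialDeriv b f (τ y) * jacobian τ y b i := by
  have h : partialDeriv i (fun z ↦ f (τ z)) y
      = fderiv ℝ f (τ y) (fderiv ℝ τ y (EuclideanSpace.single i 1)) := by
    unfold partialDeriv
    rw [show (fun z ↦ f (τ z)) = f ∘ τ from rfl, fderiv_comp y hf hτ]
    rfl
  rw [h, fderiv_apply_eq_sum]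
  refine Finset.sum_congr rfl fun b _ ↦ ?_
  rw [fderiv_apply_eq_jacobian hτ]
  simp

end Jacobian

/-! ### The curvature-dimension inequality -/

/-- Factor a = BᵀB. Cyclicity of the trace replaces aH by the symmetric matrix S = BHBᵀ, for which
tr(S²) is the sum of the squares of all entries, hence at least that of the diagonal ones;
Cauchy–Schwarz on the diagonal finishes. With a = G⁻¹ and H the Hessian this is (Δf)² ≤ n|∇²f|². -/
lemma trace_sq_le_card_mul {ι : Type*} [Fintype ι] [DecidableEq ι] {a H : Matrix ι ι ℝ}
    (ha : a.PosSemidef) (hH : Hᵀ = H) :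
    (a * H).trace ^ 2 ≤ Fintype.card ι * (a * H * (a * H)).trace := by
  obtain ⟨B, rfl⟩ : ∃ B : Matrix ι ι ℝ, a = Bᵀ * B := by
    open scoped MatrixOrder Matrix.Norms.L2Operator in
    obtain ⟨B, hB⟩ := CStarAlgebra.nonneg_iff_eq_star_mul_self.mp ha.nonneg
    exact ⟨B, by simpa [Matrix.star_eq_conjTranspose] using hB⟩
  have h1 : (Bᵀ * B * H).trace = (B * H * Bᵀ).trace := by
    rw [Matrix.mul_assoc, Matrix.trace_mul_comm]
  have h2 : (Bᵀ * B * H * (Bᵀ * B * H)).trace = (B * H * Bᵀ * (B * H * Bᵀ)).trace := by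
    rw [show Bᵀ * B * H * (Bᵀ * B * H) = Bᵀ * (B * H * (Bᵀ * B * H)) by noncomm_ring,
      Matrix.trace_mul_comm]
    congr 1; noncomm_ring
  have hS : (B * H * Bᵀ)ᵀ = B * H * Bᵀ := by
    rw [Matrix.transpose_mul, Matrix.transpose_mul, hH, Matrix.transpose_transpose,
      Matrix.mul_assoc]
  rw [h1, h2]
  set S := B * H * Bᵀ
  have h3 : ∑ i, S i i ^ 2 ≤ (S * S).trace := by
    refine Finset.sum_le_sum fun i _ ↦ ?_
    rw [Matrix.diag_apply, Matrix.mul_apply]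
    have h4 : ∀ j, S i j * S j i = S i j ^ 2 := fun j ↦ by
      rw [sq, ← congrFun (congrFun hS i) j, Matrix.transpose_apply]
    simp only [h4]
    exact Finset.single_le_sum (f := fun j ↦ S i j ^ 2) (fun j _ ↦ sq_nonneg _) (Finset.mem_univ i)
  calc S.trace ^ 2 ≤ Fintype.card ι * ∑ i, S i i ^ 2 := by
        simpa [Matrix.trace] using
          sq_sum_le_card_mul_sum_sq (s := Finset.univ) (f := fun i ↦ S i i)
    _ ≤ _ := by gcongr

section ChainRule

variable {G : Euc n → Matrix (Fin n) (Fin n) ℝ} {y : Euc n} {f : Euc n → ℝ}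

lemma laplacian_congr {h : Euc n → ℝ} (e : f =ᶠ[𝓝 y] h) : laplacian G f y = laplacian G h y := by
  simp only [laplacian, hessian, partialDeriv_congr _ e,
    partialDeriv_congr _ (partialDeriv_eventuallyEq _ e)]

lemma laplacian_comp_real {H H' : ℝ → ℝ} {H'' : ℝ} (hH : ∀ t, HasDerivAt H (H' t) t)
    (hH' : HasDerivAt H' H'' (f y)) (hf : ContDiffAt ℝ 2 f y) :
    laplacian G (fun z ↦ H (f z)) y = H' (f y) * laplacian G f y + H'' * gradInner G f f y := by
  have hev : ∀ᶠ z in 𝓝 y, DifferentiableAt ℝ f z := by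
    filter_upwards [hf.eventually (by simp)] with z h1 using h1.differentiableAt (by norm_num)
  have df := hev.self_of_nhds
  have d1 (j : Fin n) : DifferentiableAt ℝ (partialDeriv j f) y :=
    (contDiffAt_partialDeriv (m := 1) hf (by norm_num) j).differentiableAt (by norm_num)
  have d2 : DifferentiableAt ℝ (fun z ↦ H' (f z)) y := hH'.differentiableAt.comp y df
  have hHess (i j : Fin n) : hessian G (fun z ↦ H (f z)) i j y
      = H' (f y) * hessian G f i j y + H'' * (partialDeriv i f y * partialDeriv j f y) := by
    unfold hessian
    rw [partialDeriv_congr i (hev.mono fun z hz ↦ partialDeriv_comp j (hH _) hz),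
      partialDeriv_mul i d2 (d1 j), partialDeriv_comp i hH' df]
    simp only [partialDeriv_comp _ (hH _) df, mul_sub, Finset.mul_sum]
    simp only [mul_left_comm (christoffel G _ _ _ _)]
    ring
  simp only [laplacian, hHess, gradInner, grad, mul_add, Finset.sum_add_distrib, Finset.mul_sum]
  congr 1
  · simp only [mul_left_comm ((G y)⁻¹ _ _)]
  · exact Finset.sum_congr rfl fun i _ ↦ Finset.sum_congr rfl fun j _ ↦ by ring

end ChainRule

namespace IsMetricOn

variable {G G' : Euc n → Matrix (Fin n) (Fin n) ℝ} {U U' : Set (Euc n)} (hG : IsMetricOn G U)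
  {y : Euc n} (hy : y ∈ U) {f h : Euc n → ℝ}

include hG hy

lemma sum_metric_grad :
    ∑ i, ∑ j, G y i j * grad G f i y * grad G f j y = gradInner G f f y := by
  have h1 (i : Fin n) : ∑ j, G y i j * grad G f j y = partialDeriv i f y := by
    have : G y *ᵥ ((G y)⁻¹ *ᵥ fun j ↦ partialDeriv j f y) = fun j ↦ partialDeriv j f y := by
      rw [Matrix.mulVec_mulVec, hG.mul_inv hy, Matrix.one_mulVec]
    exact congrFun this i
  unfold gradInner
  refine Finset.sum_congr rfl fun i _ ↦ ?_
  rw [← h1, Finset.sum_mul]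
  exact Finset.sum_congr rfl fun j _ ↦ by ring

/-- A lower bound on the Ricci curvature implies the curvature-dimension inequality. -/
lemma curvatureDimension {K : ℝ}
    (hK : ∀ v : Fin n → ℝ, K * ∑ i, ∑ j, G y i j * v i * v j
      ≤ ∑ i, ∑ j, ricci G i j y * v i * v j)
    (hf : ContDiffAt ℝ 3 f y) :
    laplacian G f y ^ 2 / n + K * gradInner G f f y
      ≤ laplacian G (gradInner G f f) y / 2 - gradInner G f (laplacian G f) y := by
  rw [hG.bochner hy hf]
  have h1 := hK fun i ↦ grad G f i y
  rw [hG.sum_metric_grad hy] at h1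
  refine add_le_add ?_ h1
  let H : Matrix (Fin n) (Fin n) ℝ := Matrix.of fun i j ↦ hessian G f i j y
  have hH : Hᵀ = H := by
    ext i j; exact hG.hessian_symm hy (hf.of_le (by norm_num)) j i
  have h2 := trace_sq_le_card_mul (hG.posDef y hy).inv.posSemidef hH
  have hH' (i j : Fin n) : H i j = hessian G f j i y :=
    hG.hessian_symm hy (hf.of_le (by norm_num)) i j
  have e1 : ((G y)⁻¹ * H).trace = laplacian G f y := by
    simp only [Matrix.trace, Matrix.diag_apply, Matrix.mul_apply, hH', laplacian]
  have e2 : ((G y)⁻¹ * H * ((G y)⁻¹ * H)).trace = ∑ k, ∑ i,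
      (∑ j, (G y)⁻¹ i j * hessian G f k j y) * (∑ j, (G y)⁻¹ k j * hessian G f i j y) := by
    simp only [Matrix.trace, Matrix.diag_apply, Matrix.mul_apply, hH']
    exact Finset.sum_congr rfl fun k _ ↦ Finset.sum_congr rfl fun i _ ↦ mul_comm _ _
  rw [e1, e2, Fintype.card_fin] at h2
  rcases Nat.eq_zero_or_pos n with hn | hn
  -- Here both sides are zero: the quotient by zero is zero and the sums are empty.
  · subst hn; simp
  · rw [div_le_iff₀ (by exact_mod_cast hn), mul_comm]
    exact h2

/-! ### Product and chain rules for the Laplacian -/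

lemma laplacian_mul (hf : ContDiffAt ℝ 2 f y) (hh : ContDiffAt ℝ 2 h y) :
    laplacian G (fun z ↦ f z * h z) y
      = f y * laplacian G h y + h y * laplacian G f y + 2 * gradInner G f h y := by
  have hev : ∀ᶠ z in 𝓝 y, DifferentiableAt ℝ f z ∧ DifferentiableAt ℝ h z := by
    filter_upwards [hf.eventually (by simp), hh.eventually (by simp)] with z h1 h2
      using ⟨h1.differentiableAt (by norm_num), h2.differentiableAt (by norm_num)⟩
  obtain ⟨df, dh⟩ := hev.self_of_nhds
  have d1 (j : Fin n) : DifferentiableAt ℝ (partialDeriv j f) y :=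
    (contDiffAt_partialDeriv (m := 1) hf (by norm_num) j).differentiableAt (by norm_num)
  have d2 (j : Fin n) : DifferentiableAt ℝ (partialDeriv j h) y :=
    (contDiffAt_partialDeriv (m := 1) hh (by norm_num) j).differentiableAt (by norm_num)
  have hH (i j : Fin n) : hessian G (fun z ↦ f z * h z) i j y
      = f y * hessian G h i j y + h y * hessian G f i j y
        + (partialDeriv i f y * partialDeriv j h y + partialDeriv j f y * partialDeriv i h y) := by
    unfold hessian
    rw [partialDeriv_congr i (hev.mono fun z hz ↦ partialDeriv_mul j hz.1 hz.2),
      partialDeriv_add i ((d1 j).fun_mul dh) (df.fun_mul (d2 j)), partialDeriv_mul i (d1 j) dh,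
      partialDeriv_mul i df (d2 j)]
    simp only [partialDeriv_mul _ df dh, mul_add, Finset.sum_add_distrib, mul_sub, Finset.mul_sum]
    have e1 : ∑ k, christoffel G k i j y * (partialDeriv k f y * h y)
        = ∑ k, h y * (christoffel G k i j y * partialDeriv k f y) :=
      Finset.sum_congr rfl fun k _ ↦ by ring
    have e2 : ∑ k, christoffel G k i j y * (f y * partialDeriv k h y)
        = ∑ k, f y * (christoffel G k i j y * partialDeriv k h y) :=
      Finset.sum_congr rfl fun k _ ↦ by ring
    rw [e1, e2]; ring
  have e3 : gradInner G f h y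
      = ∑ i, ∑ j, (G y)⁻¹ i j * (partialDeriv i f y * partialDeriv j h y) := by
    simp only [gradInner, grad, Finset.mul_sum]
    exact Finset.sum_congr rfl fun i _ ↦ Finset.sum_congr rfl fun j _ ↦ by ring
  have e4 : gradInner G f h y
      = ∑ i, ∑ j, (G y)⁻¹ i j * (partialDeriv j f y * partialDeriv i h y) := by
    rw [hG.gradInner_comm hy]
    simp only [gradInner, grad, Finset.mul_sum]
    exact Finset.sum_congr rfl fun i _ ↦ Finset.sum_congr rfl fun j _ ↦ by ring
  rw [two_mul]
  nth_rw 1 [e3]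
  rw [e4]
  simp only [laplacian, hH, mul_add, Finset.sum_add_distrib, Finset.mul_sum]
  simp only [mul_left_comm ((G y)⁻¹ _ _)]

/-! ### Invariance of the Laplacian under changes of coordinates -/

section Invariance

variable {τ : Euc n → Euc n} (hG' : IsMetricOn G' U') (hτy : τ y ∈ U')
  (hτ : ContDiffAt ℝ 2 τ y)
  (hGG' : ∀ᶠ z in 𝓝 y, G z = (jacobian τ z)ᵀ * G' (τ z) * jacobian τ z)

include hG' hτy hτ hGG'

-- The map τ is not assumed to be a local diffeomorphism: det G > 0 and G = Jᵀ G' J force det J ≠ 0.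
omit hG' hτy hτ in
lemma isUnit_det_jacobian : IsUnit (jacobian τ y).det := by
  have h1 := hG.det_pos hy
  rw [hGG'.self_of_nhds, Matrix.det_mul] at h1
  exact (right_ne_zero_of_mul h1.ne').isUnit

/-- The transformation law of the Christoffel symbols. -/
lemma christoffel_comp (a i j : Fin n) :
    ∑ k, jacobian τ y a k * christoffel G k i j y
      = ∑ b, ∑ c, christoffel G' a b c (τ y) * jacobian τ y b i * jacobian τ y c j
        + partialDeriv i (fun z ↦ jacobian τ z a j) y := by
  set J := jacobian τ y with hJ
  -- Differentiating G = Jᵀ G'(τ) J yields terms with a second derivative D of τ (collected in S)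
  -- and terms with a derivative of G' (collected in T). As D is symmetric, S is symmetric in its
  -- first two indices, so in the alternating sum defining the Christoffel symbols all S-terms
  -- cancel except two equal ones.
  let D : Fin n → Fin n → Fin n → ℝ := fun b i j ↦ partialDeriv i (fun z ↦ jacobian τ z b j) y
  have hD (b i j : Fin n) : D b i j = D b j i := partialDeriv_comm (contDiffAt_apply hτ b) i j
  have dτ : DifferentiableAt ℝ τ y := hτ.differentiableAt (by norm_num)
  have dJ (b j : Fin n) : DifferentiableAt ℝ (fun z ↦ jacobian τ z b j) y :=
    (contDiffAt_partialDeriv (m := 1) (contDiffAt_apply hτ b) (by norm_num) j).differentiableAt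
      (by norm_num)
  have dG' (b c : Fin n) : DifferentiableAt ℝ (fun z ↦ G' (τ z) b c) y :=
    (hG'.differentiableAt hτy b c).comp y dτ
  let S : Fin n → Fin n → Fin n → ℝ := fun i j l ↦ ∑ b, ∑ c, D b i j * G' (τ y) b c * J c l
  let T : Fin n → Fin n → Fin n → ℝ := fun i j l ↦
    ∑ b, ∑ c, ∑ d, J b j * J c l * J d i * derivMatrix G' d (τ y) b c
  have hS (i j l : Fin n) : S i j l = S j i l := by simp only [S, hD _ i j]
  have hdG (i j l : Fin n) : derivMatrix G i y j l = S i j l + S i l j + T i j l := by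
    have e : (fun z ↦ G z j l) =ᶠ[𝓝 y] fun z ↦ ∑ c, ∑ b,
        jacobian τ z b j * G' (τ z) b c * jacobian τ z c l := by
      filter_upwards [hGG'] with z hz
      rw [hz]
      simp only [Matrix.mul_apply, Matrix.transpose_apply, Finset.sum_mul]
    have e2 : S i l j = ∑ b, ∑ c, J b j * G' (τ y) b c * D c i l := by
      simp only [S]
      rw [Finset.sum_comm]
      refine Finset.sum_congr rfl fun b _ ↦ Finset.sum_congr rfl fun c _ ↦ ?_
      rw [hG'.symm hτy b c]; ring
    change partialDeriv i (fun z ↦ G z j l) y = _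
    rw [partialDeriv_congr i e, partialDeriv_sum _ _ fun c _ ↦ DifferentiableAt.fun_sum fun b _ ↦
      ((dJ b j).fun_mul (dG' b c)).fun_mul (dJ c l), Finset.sum_congr rfl fun c _ ↦
      partialDeriv_sum _ _ fun b _ ↦ ((dJ b j).fun_mul (dG' b c)).fun_mul (dJ c l),
      Finset.sum_comm, e2]
    simp only [S, T, ← Finset.sum_add_distrib]
    refine Finset.sum_congr rfl fun b _ ↦ Finset.sum_congr rfl fun c _ ↦ ?_
    rw [partialDeriv_mul i ((dJ b j).fun_mul (dG' b c)) (dJ c l),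
      partialDeriv_mul i (dJ b j) (dG' b c),
      partialDeriv_comp_map (f := fun w ↦ G' w b c) dτ (hG'.differentiableAt hτy b c)]
    simp only [← hJ, D, derivMatrix, Matrix.of_apply, add_mul, Finset.mul_sum, Finset.sum_mul]
    rw [add_right_comm]
    congr 1
    exact Finset.sum_congr rfl fun d _ ↦ by ring
  -- Multiplication by the invertible matrix P lowers the index a: since P J = G, both sides become
  -- Christoffel symbols of the first kind, which involve no inverse metric.
  let P := Jᵀ * G' (τ y)
  have hPu : IsUnit P := by
    rw [Matrix.isUnit_iff_isUnit_det, Matrix.det_mul, Matrix.det_transpose]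
    exact (hG.isUnit_det_jacobian hy hGG').mul (hG'.isUnit_det hτy)
  have hinj : Function.Injective P.mulVec := Matrix.mulVec_injective_iff_isUnit.2 hPu
  refine congrFun (hinj (a₁ := fun a ↦ ∑ k, J a k * christoffel G k i j y)
    (a₂ := fun a ↦ ∑ b, ∑ c, christoffel G' a b c (τ y) * J b i * J c j + D a i j) ?_) a
  ext l
  have hL : P.mulVec (fun a ↦ ∑ k, J a k * christoffel G k i j y) l
      = ∑ m, G y l m * christoffel G m i j y := by
    have : P *ᵥ (J *ᵥ fun k ↦ christoffel G k i j y) = G y *ᵥ fun k ↦ christoffel G k i j y := by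
      rw [Matrix.mulVec_mulVec, hGG'.self_of_nhds]
    exact congrFun this l
  have hR : P.mulVec (fun a ↦ ∑ b, ∑ c, christoffel G' a b c (τ y) * J b i * J c j + D a i j) l
      = ∑ e, ∑ b, ∑ c, J e l * J b i * J c j * (∑ a, G' (τ y) e a * christoffel G' a b c (τ y))
        + S i j l := by
    simp only [Matrix.mulVec, dotProduct, P, Matrix.mul_apply, Matrix.transpose_apply, mul_add,
      Finset.sum_add_distrib, Finset.mul_sum, Finset.sum_mul, S]
    congr 1
    · rw [Finset.sum_congr rfl fun a _ ↦ Finset.sum_congr rfl fun b _ ↦ Finset.sum_comm]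
      rw [Finset.sum_congr rfl fun a _ ↦ Finset.sum_comm, Finset.sum_comm]
      rw [Finset.sum_congr rfl fun a _ ↦ Finset.sum_congr rfl fun b _ ↦ Finset.sum_comm]
      rw [Finset.sum_congr rfl fun a _ ↦ Finset.sum_comm]
      rw [Finset.sum_congr rfl fun a _ ↦ Finset.sum_congr rfl fun b _ ↦ Finset.sum_comm]
      rw [Finset.sum_congr rfl fun a _ ↦ Finset.sum_comm]
      refine Finset.sum_congr rfl fun e _ ↦ Finset.sum_congr rfl fun b _ ↦
        Finset.sum_congr rfl fun c _ ↦ Finset.sum_congr rfl fun d _ ↦ by ring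
    · refine Finset.sum_congr rfl fun b _ ↦ Finset.sum_congr rfl fun c _ ↦ ?_
      rw [hG'.symm hτy b c]; ring
  rw [hL, hR, hG.sum_mul_christoffel hy, hdG, hdG, hdG, hS j i l, hS l i j, hS l j i]
  simp only [hG'.sum_mul_christoffel hτy]
  have hT : ∑ e, ∑ b, ∑ c, J e l * J b i * J c j * (1 / 2 * (derivMatrix G' b (τ y) c e
      + derivMatrix G' c (τ y) b e - derivMatrix G' e (τ y) b c))
      = 1 / 2 * (T i j l + T j i l - T l i j) := by
    have t1 : T i j l = ∑ e, ∑ b, ∑ c, J e l * J b i * J c j * derivMatrix G' b (τ y) c e := by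
      simp only [T]
      rw [Finset.sum_comm]
      refine Finset.sum_congr rfl fun e _ ↦ ?_
      rw [Finset.sum_comm]
      exact Finset.sum_congr rfl fun b _ ↦ Finset.sum_congr rfl fun c _ ↦ by ring
    have t2 : T j i l = ∑ e, ∑ b, ∑ c, J e l * J b i * J c j * derivMatrix G' c (τ y) b e := by
      simp only [T]
      rw [Finset.sum_comm]
      exact Finset.sum_congr rfl fun e _ ↦ Finset.sum_congr rfl fun b _ ↦
        Finset.sum_congr rfl fun c _ ↦ by ring
    have t3 : T l i j = ∑ e, ∑ b, ∑ c, J e l * J b i * J c j * derivMatrix G' e (τ y) b c := by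
      simp only [T]
      rw [Finset.sum_congr rfl fun b _ ↦ Finset.sum_comm, Finset.sum_comm]
      exact Finset.sum_congr rfl fun e _ ↦ Finset.sum_congr rfl fun b _ ↦
        Finset.sum_congr rfl fun c _ ↦ by ring
    rw [t1, t2, t3]
    simp only [← Finset.sum_add_distrib, ← Finset.sum_sub_distrib, Finset.mul_sum]
    exact Finset.sum_congr rfl fun e _ ↦ Finset.sum_congr rfl fun b _ ↦
      Finset.sum_congr rfl fun c _ ↦ by ring
  rw [hT]
  ring

/-- The chain rule produces an extra term ∂f · ∂²τ; the inhomogeneous term of `christoffel_comp`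
cancels it exactly, so the Hessian transforms as a tensor. -/
lemma hessian_comp (hf : ContDiffAt ℝ 2 f (τ y)) (i j : Fin n) :
    hessian G (fun z ↦ f (τ z)) i j y
      = ∑ a, ∑ b, jacobian τ y b i * hessian G' f b a (τ y) * jacobian τ y a j := by
  have dτ : DifferentiableAt ℝ τ y := hτ.differentiableAt (by norm_num)
  have hev : ∀ᶠ z in 𝓝 y, DifferentiableAt ℝ τ z ∧ DifferentiableAt ℝ f (τ z) := by
    filter_upwards [hτ.eventually (by simp),
      dτ.continuousAt.eventually (hf.eventually (by simp))] with z h1 h2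
      using ⟨h1.differentiableAt (by norm_num), h2.differentiableAt (by norm_num)⟩
  have dJ (b j : Fin n) : DifferentiableAt ℝ (fun z ↦ jacobian τ z b j) y :=
    (contDiffAt_partialDeriv (m := 1) (contDiffAt_apply hτ b) (by norm_num) j).differentiableAt
      (by norm_num)
  have d1 (j : Fin n) : DifferentiableAt ℝ (partialDeriv j f) (τ y) :=
    (contDiffAt_partialDeriv (m := 1) hf (by norm_num) j).differentiableAt (by norm_num)
  have d1' (j : Fin n) : DifferentiableAt ℝ (fun z ↦ partialDeriv j f (τ z)) y := (d1 j).comp y dτ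
  have hchr : ∑ k, christoffel G k i j y * ∑ a, partialDeriv a f (τ y) * jacobian τ y a k
      = ∑ a, partialDeriv a f (τ y) * ∑ k, jacobian τ y a k * christoffel G k i j y := by
    simp only [Finset.mul_sum]
    rw [Finset.sum_comm]
    exact Finset.sum_congr rfl fun a _ ↦ Finset.sum_congr rfl fun k _ ↦ by ring
  unfold hessian
  rw [partialDeriv_congr i (hev.mono fun z hz ↦ partialDeriv_comp_map hz.1 hz.2 j),
    partialDeriv_sum _ _ fun a _ ↦ (d1' a).fun_mul (dJ a j),
    Finset.sum_congr rfl fun a _ ↦ partialDeriv_mul i (d1' a) (dJ a j)]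
  simp only [partialDeriv_comp_map dτ hev.self_of_nhds.2, partialDeriv_comp_map dτ (d1 _)]
  rw [hchr]
  simp only [hG.christoffel_comp hy hG' hτy hτ hGG', mul_add, mul_sub, sub_mul, Finset.sum_add_distrib,
    Finset.sum_sub_distrib, Finset.mul_sum, Finset.sum_mul]
  rw [add_sub_add_right_eq_sub]
  congr 1
  · exact Finset.sum_congr rfl fun a _ ↦ Finset.sum_congr rfl fun b _ ↦ by ring
  · rw [Finset.sum_congr rfl fun a _ ↦ Finset.sum_comm, Finset.sum_comm,
      Finset.sum_congr rfl fun a _ ↦ Finset.sum_comm]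
    exact Finset.sum_congr rfl fun a _ ↦ Finset.sum_congr rfl fun b _ ↦
      Finset.sum_congr rfl fun c _ ↦ by ring

/-- The Laplacian does not depend on the coordinates. -/
theorem laplacian_comp (hf : ContDiffAt ℝ 2 f (τ y)) :
    laplacian G (fun z ↦ f (τ z)) y = laplacian G' f (τ y) := by
  have hJ := hG.isUnit_det_jacobian hy hGG'
  set J := jacobian τ y
  let H : Matrix (Fin n) (Fin n) ℝ := Matrix.of fun i j ↦ hessian G' f i j (τ y)
  have h1 (i j : Fin n) : hessian G (fun z ↦ f (τ z)) i j y = (Jᵀ * H * J) i j := by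
    rw [hG.hessian_comp hy hG' hτy hτ hGG' hf]
    simp only [Matrix.mul_apply, Matrix.transpose_apply, Finset.sum_mul]
    rfl
  have h2 (A B : Matrix (Fin n) (Fin n) ℝ) : ∑ i, ∑ j, A i j * B i j = (A * Bᵀ).trace := by
    simp [Matrix.trace, Matrix.mul_apply]
  have h3 : laplacian G' f (τ y) = ((G' (τ y))⁻¹ * Hᵀ).trace := h2 _ H
  rw [h3]
  simp only [laplacian, h1]
  rw [h2, hGG'.self_of_nhds, Matrix.mul_inv_rev, Matrix.mul_inv_rev, Matrix.transpose_mul,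
    Matrix.transpose_mul, Matrix.transpose_transpose, Matrix.trace_mul_comm]
  have hJt : IsUnit (Jᵀ).det := by rwa [Matrix.det_transpose]
  -- The Hessian transforms with J on both sides, the inverse metric with J⁻¹, so the Jacobians
  -- cancel under the trace.
  calc (Jᵀ * (Hᵀ * J) * (J⁻¹ * ((G' (τ y))⁻¹ * (Jᵀ)⁻¹))).trace
      = (Jᵀ * (Hᵀ * (J * J⁻¹) * ((G' (τ y))⁻¹ * (Jᵀ)⁻¹))).trace := by
        congr 1; noncomm_ring
    _ = (Hᵀ * (G' (τ y))⁻¹ * ((Jᵀ)⁻¹ * Jᵀ)).trace := by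
        rw [Matrix.mul_nonsing_inv _ hJ, Matrix.trace_mul_comm]
        congr 1; noncomm_ring
    _ = _ := by
        rw [Matrix.nonsing_inv_mul _ hJt, Matrix.mul_one, Matrix.trace_mul_comm]

end Invariance

end IsMetricOn

end LocalGeometry

/-! ### Divergence theorem, Green's formula and the weighted Bochner inequality in a chart. -/

namespace LocalGeometry

open Filter Topology Matrix MeasureTheory

variable {n : ℕ}

/-- The integral of a partial derivative of a compactly supported `C¹` function vanishes. -/
lemma integral_partialDeriv_eq_zero {f : Euc n → ℝ} (hf : ContDiff ℝ 1 f)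
    (hc : HasCompactSupport f) (i : Fin n) : ∫ y, partialDeriv i f y = 0 := by
  have hi : Integrable (partialDeriv i f) :=
    ((hf.continuous_fderiv (by norm_num)).clm_apply continuous_const).integrable_of_hasCompactSupport
      (hc.fderiv_apply (𝕜 := ℝ) _)
  -- Integration by parts against the constant function 1.
  have := integral_mul_fderiv_eq_neg_fderiv_mul_of_integrable (μ := volume) (𝕜 := ℝ)
    (f := fun _ : Euc n ↦ (1 : ℝ)) (g := f) (v := EuclideanSpace.single i 1)
    (by simp) (by simp only [one_mul]; exact hi) (by simpa using hf.continuous.integrable_of_hasCompactSupport hc)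
    (fun x _ ↦ differentiableAt_const _) (fun x _ ↦ hf.differentiable (by norm_num) x)
  simpa [partialDeriv] using this

lemma integrableOn_of_continuousOn_of_zero {F : Euc n → ℝ} {U C : Set (Euc n)}
    (hU : IsOpen U) (hC : IsCompact C) (hCU : C ⊆ U) (hF : ContinuousOn F U)
    (h0 : ∀ y ∈ U, y ∉ C → F y = 0) : IntegrableOn F U :=
  ((hF.mono hCU).integrableOn_compact hC).of_forall_sdiff_eq_zero hU.measurableSet
    fun y hy ↦ h0 y hy.1 hy.2

lemma partialDeriv_eq_zero_of_notMem {f : Euc n → ℝ} {C : Set (Euc n)} (hC : IsClosed C)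
    (hf : ∀ y ∉ C, f y = 0) {y : Euc n} (hy : y ∉ C) (i : Fin n) : partialDeriv i f y = 0 := by
  rw [partialDeriv_congr i (h := fun _ ↦ 0), partialDeriv_const]
  filter_upwards [hC.isOpen_compl.mem_nhds hy] with z hz using hf z hz

lemma grad_eq_zero_of_notMem (G : Euc n → Matrix (Fin n) (Fin n) ℝ) {w : Euc n → ℝ}
    {C : Set (Euc n)} (hC : IsCompact C) (h0 : ∀ y ∉ C, w y = 0) {y : Euc n} (hy : y ∉ C)
    (k : Fin n) : grad G w k y = 0 := by
  simp [grad, partialDeriv_eq_zero_of_notMem hC.isClosed h0 hy]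

namespace IsMetricOn

variable {G : Euc n → Matrix (Fin n) (Fin n) ℝ} {U C : Set (Euc n)} (hG : IsMetricOn G U)
  {f h w : Euc n → ℝ}

include hG

/-- The divergence theorem for compactly supported vector fields. -/
lemma integral_divergence_eq_zero (hC : IsCompact C) (hCU : C ⊆ U) {X : Fin n → Euc n → ℝ}
    (hX : ∀ y ∈ U, ∀ k, ContDiffAt ℝ 1 (X k) y) (h0 : ∀ k, ∀ y ∉ C, X k y = 0) :
    ∫ y in U, divergence G X y * volDensity G y = 0 := by
  -- Because ∂ₖ√det G = √det G · ∑ Γˡₗₖ, the divergence times the density is the flat divergence of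
  -- Y = X√det G. Compact support of X makes Y globally C¹, although G is only controlled on U.
  let Y : Fin n → Euc n → ℝ := fun k z ↦ X k z * volDensity G z
  have hY0 (k : Fin n) : ∀ y ∉ C, Y k y = 0 := fun y hy ↦ by simp [Y, h0 k y hy]
  have hYc (k : Fin n) : HasCompactSupport (Y k) := HasCompactSupport.intro hC (hY0 k)
  have hYd (k : Fin n) : ContDiff ℝ 1 (Y k) := by
    rw [contDiff_iff_contDiffAt]
    intro y
    by_cases hy : y ∈ U
    · exact (hX y hy k).mul ((hG.contDiffAt_volDensity hy).of_le (by simp))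
    · have : Y k =ᶠ[𝓝 y] fun _ ↦ 0 := by
        filter_upwards [hC.isClosed.isOpen_compl.mem_nhds fun h ↦ hy (hCU h)] with z hz
          using hY0 k z hz
      exact contDiffAt_const.congr_of_eventuallyEq this
  have hdiv : ∀ y ∈ U, divergence G X y * volDensity G y = ∑ k, partialDeriv k (Y k) y := by
    intro y hy
    have hd (k : Fin n) : partialDeriv k (Y k) y = partialDeriv k (X k) y * volDensity G y
        + X k y * (volDensity G y * ∑ l, christoffel G l l k y) := by
      rw [← hG.partialDeriv_volDensity hy]
      exact partialDeriv_mul k ((hX y hy k).differentiableAt (by norm_num))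
        ((hG.contDiffAt_volDensity hy).differentiableAt (by simp))
    simp only [hd, Finset.sum_add_distrib, divergence, add_mul, Finset.sum_mul, Finset.mul_sum]
    congr 1
    rw [Finset.sum_comm]
    exact Finset.sum_congr rfl fun l _ ↦ Finset.sum_congr rfl fun k _ ↦ by ring
  rw [setIntegral_congr_fun hG.isOpen.measurableSet hdiv,
    setIntegral_eq_integral_of_forall_compl_eq_zero, integral_finsetSum]
  · exact Finset.sum_eq_zero fun k _ ↦ integral_partialDeriv_eq_zero (hYd k) (hYc k) k
  · intro k _
    exact (((hYd k).continuous_fderiv (by norm_num)).clm_apply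
      continuous_const).integrable_of_hasCompactSupport ((hYc k).fderiv_apply (𝕜 := ℝ) _)
  · intro y hy
    exact Finset.sum_eq_zero fun k _ ↦
      partialDeriv_eq_zero_of_notMem hC.isClosed (hY0 k) (fun h ↦ hy (hCU h)) k

lemma divergence_mul_grad {y : Euc n} (hy : y ∈ U) (hh : ContDiffAt ℝ 1 h y)
    (hf : ContDiffAt ℝ 2 f y) :
    divergence G (fun k z ↦ h z * grad G f k z) y
      = h y * laplacian G f y + gradInner G h f y := by
  have d1 (k : Fin n) : DifferentiableAt ℝ (grad G f k) y :=
    (hG.contDiffAt_grad (m := 1) hy hf (by norm_num) (by simp) k).differentiableAt (by norm_num)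
  rw [hG.laplacian_eq_divergence hy hf]
  simp only [divergence, partialDeriv_mul _ (hh.differentiableAt (by norm_num)) (d1 _),
    Finset.sum_add_distrib, mul_add, gradInner, Finset.mul_sum, mul_left_comm (h y)]
  ring

lemma continuousOn_laplacian (hf : ∀ y ∈ U, ContDiffAt ℝ 2 f y) :
    ContinuousOn (laplacian G f) U := fun y hy ↦
  (hG.contDiffAt_laplacian (m := 0) hy (hf y hy) (by norm_num) (by simp)).continuousAt.continuousWithinAt

lemma continuousOn_gradInner (hf : ∀ y ∈ U, ContDiffAt ℝ 1 f y)
    (hh : ∀ y ∈ U, ContDiffAt ℝ 1 h y) : ContinuousOn (gradInner G f h) U := fun y hy ↦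
  (hG.contDiffAt_gradInner (m := 0) hy (hf y hy) (hh y hy) (by norm_num)
    (by simp)).continuousAt.continuousWithinAt

lemma continuousOn_volDensity : ContinuousOn (volDensity G) U := fun _ hy ↦
  (hG.contDiffAt_volDensity hy).continuousAt.continuousWithinAt

/-- Green's formula. -/
lemma integral_green (hC : IsCompact C) (hCU : C ⊆ U) (hh : ∀ y ∈ U, ContDiffAt ℝ 1 h y)
    (hf : ∀ y ∈ U, ContDiffAt ℝ 2 f y) (h0 : ∀ y ∉ C, ∀ k, h y * grad G f k y = 0) :
    IntegrableOn (fun y ↦ (h y * laplacian G f y + gradInner G h f y) * volDensity G y) U ∧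
      ∫ y in U, (h y * laplacian G f y + gradInner G h f y) * volDensity G y = 0 := by
  have hdiv : ∀ y ∈ U, (h y * laplacian G f y + gradInner G h f y) * volDensity G y
      = divergence G (fun k z ↦ h z * grad G f k z) y * volDensity G y := fun y hy ↦ by
    rw [hG.divergence_mul_grad hy (hh y hy) (hf y hy)]
  constructor
  · refine integrableOn_of_continuousOn_of_zero hG.isOpen hC hCU ?_ ?_
    · have ch : ContinuousOn h U := fun y hy ↦ (hh y hy).continuousAt.continuousWithinAt
      exact ((ch.mul (hG.continuousOn_laplacian hf)).add (hG.continuousOn_gradInner hh fun y hy ↦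
          (hf y hy).of_le (by norm_num))).mul hG.continuousOn_volDensity
    · intro y hy hyC
      rw [hdiv y hy]
      simp [divergence, h0 y hyC,
        partialDeriv_eq_zero_of_notMem hC.isClosed (fun z hz ↦ h0 z hz _) hyC]
  · rw [setIntegral_congr_fun hG.isOpen.measurableSet hdiv]
    exact hG.integral_divergence_eq_zero hC hCU (fun y hy k ↦ (hh y hy).mul
      (hG.contDiffAt_grad hy (hf y hy) (by norm_num) (by simp) k)) fun k y hy ↦ h0 y hy k

end IsMetricOn

/-- The integrand of the weighted Bochner inequality. -/
noncomputable def bochnerIntegrand (G : Euc n → Matrix (Fin n) (Fin n) ℝ) (K : ℝ)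
    (w f : Euc n → ℝ) (y : Euc n) : ℝ :=
  gradInner G f f y * laplacian G w y / 2 + laplacian G f y * gradInner G f w y
    + w y * (laplacian G f y ^ 2 - laplacian G f y ^ 2 / n) - K * w y * gradInner G f f y

namespace IsMetricOn

variable {G : Euc n → Matrix (Fin n) (Fin n) ℝ} {U C : Set (Euc n)} (hG : IsMetricOn G U)
  {f h w : Euc n → ℝ} {K : ℝ}

include hG

/-- The weighted Bochner inequality for `C³` functions. -/
lemma integral_bochnerIntegrand_nonneg_of_contDiff (hC : IsCompact C) (hCU : C ⊆ U)
    (hCD : ∀ y ∈ U, laplacian G f y ^ 2 / n + K * gradInner G f f y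
      ≤ laplacian G (gradInner G f f) y / 2 - gradInner G f (laplacian G f) y)
    (hf : ∀ y ∈ U, ContDiffAt ℝ 3 f y) (hw : ∀ y ∈ U, ContDiffAt ℝ 2 w y)
    (hw0 : ∀ y ∈ U, 0 ≤ w y) (h0 : ∀ y ∉ C, w y = 0) :
    0 ≤ ∫ y in U, bochnerIntegrand G K w f y * volDensity G y := by
  have hf2 : ∀ y ∈ U, ContDiffAt ℝ 2 f y := fun y hy ↦ (hf y hy).of_le (by norm_num)
  have hw1 : ∀ y ∈ U, ContDiffAt ℝ 1 w y := fun y hy ↦ (hw y hy).of_le (by norm_num)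
  have hψ : ∀ y ∈ U, ContDiffAt ℝ 2 (gradInner G f f) y := fun y hy ↦
    hG.contDiffAt_gradInner hy (hf y hy) (hf y hy) (by norm_num) ENat.LEInfty.out
  have hψ1 : ∀ y ∈ U, ContDiffAt ℝ 1 (gradInner G f f) y := fun y hy ↦
    (hψ y hy).of_le (by norm_num)
  have hL : ∀ y ∈ U, ContDiffAt ℝ 1 (laplacian G f) y := fun y hy ↦
    hG.contDiffAt_laplacian hy (hf y hy) (by norm_num) (by simp)
  -- Three uses of Green's formula: the first two, subtracted, move the Laplacian from |∇f|² to w;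
  -- the third, with multiplier wΔf, removes the derivative of Δf. In each, the product of the
  -- multiplier with the gradient vanishes off C because of w.
  obtain ⟨i1, e1⟩ := hG.integral_green hC hCU hψ1 hw
    fun y hy k ↦ by rw [grad_eq_zero_of_notMem G hC h0 hy, mul_zero]
  obtain ⟨i2, e2⟩ := hG.integral_green hC hCU hw1 hψ fun y hy k ↦ by rw [h0 y hy, zero_mul]
  obtain ⟨i3, e3⟩ := hG.integral_green (h := fun z ↦ w z * laplacian G f z) hC hCU
    (fun y hy ↦ (hw1 y hy).mul (hL y hy)) hf2 fun y hy k ↦ by rw [h0 y hy, zero_mul, zero_mul]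
  -- P is w times the defect in the curvature-dimension inequality. It is the only contribution to
  -- the integral that is not zero by Green's formula, and it is pointwise non-negative on U.
  let P : Euc n → ℝ := fun y ↦ w y * (laplacian G (gradInner G f f) y / 2
    - gradInner G f (laplacian G f) y - (laplacian G f y ^ 2 / n + K * gradInner G f f y))
      * volDensity G y
  have iP : IntegrableOn P U := by
    refine integrableOn_of_continuousOn_of_zero hG.isOpen hC hCU ?_ fun y _ hy ↦ by
      simp [P, h0 y hy]
    have c1 : ContinuousOn w U := fun y hy ↦ (hw y hy).continuousAt.continuousWithinAt
    have c2 := hG.continuousOn_laplacian hψ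
    have c3 := hG.continuousOn_laplacian hf2
    have c4 := hG.continuousOn_gradInner (fun y hy ↦ (hf y hy).of_le (by norm_num)) hL
    have c5 : ContinuousOn (gradInner G f f) U := fun y hy ↦
      (hψ y hy).continuousAt.continuousWithinAt
    exact (c1.mul (((c2.div_const _).sub c4).sub (((c3.pow 2).div_const _).add
      (continuousOn_const.mul c5)))).mul hG.continuousOn_volDensity
  have eP : 0 ≤ ∫ y in U, P y := setIntegral_nonneg hG.isOpen.measurableSet fun y hy ↦
    mul_nonneg (mul_nonneg (hw0 y hy) (sub_nonneg.2 (hCD y hy))) (hG.volDensity_pos hy).le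
  have key : ∀ y ∈ U, bochnerIntegrand G K w f y * volDensity G y
      = P y + 2⁻¹ * ((gradInner G f f y * laplacian G w y + gradInner G (gradInner G f f) w y)
          * volDensity G y)
        - 2⁻¹ * ((w y * laplacian G (gradInner G f f) y + gradInner G w (gradInner G f f) y)
          * volDensity G y)
        + (w y * laplacian G f y * laplacian G f y
          + gradInner G (fun z ↦ w z * laplacian G f z) f y) * volDensity G y := by
    intro y hy
    have h1 : gradInner G (fun z ↦ w z * laplacian G f z) f y
        = w y * gradInner G f (laplacian G f) y + laplacian G f y * gradInner G f w y := by
      rw [hG.gradInner_comm hy (f := f), hG.gradInner_comm hy (f := f)]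
      simp only [gradInner, partialDeriv_mul _ ((hw1 y hy).differentiableAt (by norm_num))
        ((hL y hy).differentiableAt (by norm_num)), Finset.mul_sum, ← Finset.sum_add_distrib]
      exact Finset.sum_congr rfl fun i _ ↦ by ring
    rw [h1, hG.gradInner_comm hy (f := gradInner G f f)]
    simp only [bochnerIntegrand, P]
    ring
  rw [setIntegral_congr_fun hG.isOpen.measurableSet key]
  have s1 := integral_add ((iP.add (i1.const_mul 2⁻¹)).sub (i2.const_mul 2⁻¹)) i3
  have s2 := integral_sub (iP.add (i1.const_mul 2⁻¹)) (i2.const_mul 2⁻¹)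
  have s3 := integral_add iP (i1.const_mul 2⁻¹)
  simp only [Pi.add_apply, Pi.sub_apply, integral_const_mul] at s1 s2 s3
  rw [s1, s2, s3, e1, e2, e3]
  simpa using eP

end IsMetricOn

end LocalGeometry

/-! ### Mollification and extension of the inequality to C² functions. -/

namespace LocalGeometry

open Filter Topology Matrix MeasureTheory

variable {n : ℕ}

section Mollification

open ContinuousLinearMap

/-- A sequence of smooth bump functions with supports shrinking to the origin. -/
noncomputable def shrinkingBump (n k : ℕ) : ContDiffBump (0 : Euc n) where
  rIn := 1 / (2 * ((k : ℝ) + 1))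
  rOut := 1 / ((k : ℝ) + 1)
  rIn_pos := by positivity
  rIn_lt_rOut := by
    have : (0 : ℝ) < (k : ℝ) + 1 := by positivity
    apply one_div_lt_one_div_of_lt this
    linarith

lemma tendsto_shrinkingBump_rOut :
    Tendsto (fun k ↦ (shrinkingBump n k).rOut) atTop (𝓝 0) :=
  tendsto_one_div_add_atTop_nhds_zero_nat

/-- Convolution with `shrinkingBump n k`. -/
noncomputable def mollify (k : ℕ) (g : Euc n → ℝ) : Euc n → ℝ :=
  convolution ((shrinkingBump n k).normed volume) g (lsmul ℝ ℝ) volume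

variable {g : Euc n → ℝ}

lemma contDiff_mollify (hg : Continuous g) (k : ℕ) : ContDiff ℝ ∞ (mollify k g) :=
  (shrinkingBump n k).hasCompactSupport_normed.contDiff_convolution_left _
    (shrinkingBump n k).contDiff_normed hg.locallyIntegrable

lemma tendsto_mollify (hg : Continuous g) (y : Euc n) :
    Tendsto (fun k ↦ mollify k g y) atTop (𝓝 (g y)) :=
  ContDiffBump.convolution_tendsto_right_of_continuous tendsto_shrinkingBump_rOut hg y

lemma partialDeriv_mollify (hg : ContDiff ℝ 1 g) (hc : HasCompactSupport g) (i : Fin n) (k : ℕ) :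
    partialDeriv i (mollify k g) = mollify k (partialDeriv i g) := by
  have hl : LocallyIntegrable ((shrinkingBump n k).normed volume) (volume : Measure (Euc n)) :=
    (shrinkingBump n k).continuous_normed.locallyIntegrable
  ext y
  unfold partialDeriv mollify
  rw [(hc.hasFDerivAt_convolution_right (lsmul ℝ ℝ) hl hg y).fderiv,
    convolution_precompR_apply _ hl (hc.fderiv ℝ) (hg.continuous_fderiv (by norm_num))]

/-- The factor 3 is B for g itself plus 2B for the oscillation of g; only independence of k matters.
-/
lemma abs_mollify_le (hg : Continuous g) {B : ℝ} (hB : ∀ y, |g y| ≤ B) (k : ℕ) (y : Euc n) :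
    |mollify k g y| ≤ 3 * B := by
  have h1 : dist (mollify k g y) (g y) ≤ 2 * B :=
    ContDiffBump.dist_normed_convolution_le hg.aestronglyMeasurable fun x _ ↦ by
      rw [Real.dist_eq]
      have := abs_sub (g x) (g y)
      linarith [hB x, hB y]
  rw [Real.dist_eq] at h1
  have h2 := abs_sub_abs_le_abs_sub (mollify k g y) (g y)
  linarith [hB y]

lemma continuous_partialDeriv (hg : ContDiff ℝ 1 g) (i : Fin n) : Continuous (partialDeriv i g) :=
  (hg.continuous_fderiv (by norm_num)).clm_apply continuous_const

lemma hasCompactSupport_partialDeriv (hc : HasCompactSupport g) (i : Fin n) :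
    HasCompactSupport (partialDeriv i g) := hc.fderiv_apply (𝕜 := ℝ) _

/-- A compactly supported `C²` function is approximated by smooth functions, with convergence
and uniform boundedness of the first and second derivatives. -/
lemma exists_contDiff_approx (hg : ContDiff ℝ 2 g) (hc : HasCompactSupport g) :
    ∃ (F : ℕ → Euc n → ℝ) (B : ℝ), 0 ≤ B ∧ (∀ k, ContDiff ℝ ∞ (F k)) ∧
      (∀ i y, Tendsto (fun k ↦ partialDeriv i (F k) y) atTop (𝓝 (partialDeriv i g y))) ∧
      (∀ i j y, Tendsto (fun k ↦ partialDeriv i (partialDeriv j (F k)) y) atTop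
        (𝓝 (partialDeriv i (partialDeriv j g) y))) ∧
      (∀ k i y, |partialDeriv i (F k) y| ≤ B) ∧
      (∀ k i j y, |partialDeriv i (partialDeriv j (F k)) y| ≤ B) := by
  have hg1 : ContDiff ℝ 1 g := hg.of_le (by norm_num)
  have hp (i : Fin n) : ContDiff ℝ 1 (partialDeriv i g) := contDiff_iff_contDiffAt.2 fun y ↦
    contDiffAt_partialDeriv hg.contDiffAt (by norm_num) i
  have c1 (i : Fin n) := continuous_partialDeriv hg1 i
  have c2 (i j : Fin n) := continuous_partialDeriv (hp j) i
  have s1 (i : Fin n) := hasCompactSupport_partialDeriv hc i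
  have s2 (i j : Fin n) := hasCompactSupport_partialDeriv (s1 j) i
  choose B1 hB1 using fun i ↦ (s1 i).exists_bound_of_continuous (c1 i)
  choose B2 hB2 using fun i j ↦ (s2 i j).exists_bound_of_continuous (c2 i j)
  have n1 (i : Fin n) : 0 ≤ B1 i := (norm_nonneg _).trans (hB1 i 0)
  have n2 (i j : Fin n) : 0 ≤ B2 i j := (norm_nonneg _).trans (hB2 i j 0)
  have m1 (i : Fin n) : B1 i ≤ ∑ i, B1 i + ∑ i, ∑ j, B2 i j :=
    (Finset.single_le_sum (fun i _ ↦ n1 i) (Finset.mem_univ i)).trans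
      (le_add_of_nonneg_right (Finset.sum_nonneg fun i _ ↦ Finset.sum_nonneg fun j _ ↦ n2 i j))
  have m2 (i j : Fin n) : B2 i j ≤ ∑ i, B1 i + ∑ i, ∑ j, B2 i j :=
    ((Finset.single_le_sum (fun j _ ↦ n2 i j) (Finset.mem_univ j)).trans
      (Finset.single_le_sum (f := fun i ↦ ∑ j, B2 i j)
        (fun i _ ↦ Finset.sum_nonneg fun j _ ↦ n2 i j) (Finset.mem_univ i))).trans
      (le_add_of_nonneg_left (Finset.sum_nonneg fun i _ ↦ n1 i))
  -- The sum of all the bounds dominates each of them, so a single constant serves every derivative;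
  -- the 3 comes from `abs_mollify_le`. Derivatives commute with mollification, which reduces the
  -- claims to convolutions of continuous functions.
  refine ⟨fun k ↦ mollify k g, 3 * (∑ i, B1 i + ∑ i, ∑ j, B2 i j), ?_, contDiff_mollify hg.continuous,
    fun i y ↦ ?_, fun i j y ↦ ?_, fun k i y ↦ ?_, fun k i j y ↦ ?_⟩
  · have := Finset.sum_nonneg fun i (_ : i ∈ Finset.univ) ↦ n1 i
    have := Finset.sum_nonneg fun i (_ : i ∈ Finset.univ) ↦
      Finset.sum_nonneg fun j (_ : j ∈ Finset.univ) ↦ n2 i j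
    positivity
  · simpa only [partialDeriv_mollify hg1 hc] using tendsto_mollify (c1 i) y
  · simpa only [partialDeriv_mollify hg1 hc, partialDeriv_mollify (hp _) (s1 _)]
      using tendsto_mollify (c2 i j) y
  · rw [partialDeriv_mollify hg1 hc]
    exact abs_mollify_le (c1 i) (fun y ↦ (hB1 i y).trans (m1 i)) k y
  · rw [partialDeriv_mollify hg1 hc, partialDeriv_mollify (hp _) (s1 _)]
    exact abs_mollify_le (c2 i j) (fun y ↦ (hB2 i j y).trans (m2 i j)) k y

end Mollification

/-- The weighted Bochner integrand as a function of the point and of the first and second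
derivatives there. -/
noncomputable def bochnerJet (G : Euc n → Matrix (Fin n) (Fin n) ℝ) (K : ℝ) (w : Euc n → ℝ)
    (x : Euc n × (Fin n → ℝ) × (Fin n → Fin n → ℝ)) : ℝ :=
  let E := ∑ i, x.2.1 i * ∑ j, (G x.1)⁻¹ i j * x.2.1 j
  let L := ∑ i, ∑ j, (G x.1)⁻¹ i j * (x.2.2 i j - ∑ k, christoffel G k i j x.1 * x.2.1 k)
  E * laplacian G w x.1 / 2 + L * (∑ i, x.2.1 i * grad G w i x.1)
    + w x.1 * (L ^ 2 - L ^ 2 / n) - K * w x.1 * E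

lemma bochnerIntegrand_eq_jet (G : Euc n → Matrix (Fin n) (Fin n) ℝ) (K : ℝ)
    (w f : Euc n → ℝ) (y : Euc n) : bochnerIntegrand G K w f y
      = bochnerJet G K w (y, (fun i ↦ partialDeriv i f y),
          fun i j ↦ partialDeriv i (partialDeriv j f) y) := rfl

lemma bochnerIntegrand_eq_zero_of_notMem {G : Euc n → Matrix (Fin n) (Fin n) ℝ} {K : ℝ}
    {w f : Euc n → ℝ} {C : Set (Euc n)} (hC : IsCompact C) (h0 : ∀ y ∉ C, w y = 0) {y : Euc n}
    (hy : y ∉ C) : bochnerIntegrand G K w f y = 0 := by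
  have hp {z : Euc n} (hz : z ∉ C) (i : Fin n) : partialDeriv i w z = 0 :=
    partialDeriv_eq_zero_of_notMem hC.isClosed h0 hz i
  have hpp (i j : Fin n) : partialDeriv i (partialDeriv j w) y = 0 :=
    partialDeriv_eq_zero_of_notMem hC.isClosed (fun z hz ↦ hp hz j) hy i
  simp [bochnerIntegrand, laplacian, hessian, gradInner, grad, h0 y hy, hp hy, hpp]

/-- A `C²` function on an open set agrees near a given compact subset with a compactly supported
`C²` function. -/
lemma exists_contDiff_hasCompactSupport_eq {f : Euc n → ℝ} {U C : Set (Euc n)} (hC : IsCompact C)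
    (hU : IsOpen U) (hCU : C ⊆ U) (hf : ∀ y ∈ U, ContDiffAt ℝ 2 f y) :
    ∃ g : Euc n → ℝ, ContDiff ℝ 2 g ∧ HasCompactSupport g ∧ ∀ y ∈ C, g =ᶠ[𝓝 y] f := by
  obtain ⟨C', hC', hCC', hC'U⟩ := exists_compact_between hC hU hCU
  -- A smooth cutoff equal to 1 near C and vanishing off the compact set C' between C and U, so that
  -- χf extends by zero.
  obtain ⟨χ, hχ1, hχ0, -⟩ := exists_contMDiffMap_one_nhds_of_subset_interior (n := ⊤)
    𝓘(ℝ, Euc n) hC.isClosed hCC'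
  have hχs : ContDiff ℝ ∞ χ := χ.contMDiff.contDiff
  have hg0 : ∀ y ∉ C', χ y * f y = 0 := fun y hy ↦ by simp [hχ0 y hy]
  refine ⟨fun y ↦ χ y * f y, ?_, HasCompactSupport.intro hC' hg0, fun y hy ↦ ?_⟩
  · rw [contDiff_iff_contDiffAt]
    intro y
    by_cases hy : y ∈ U
    · exact (hχs.contDiffAt.of_le ENat.LEInfty.out).mul (hf y hy)
    · have : (fun y ↦ χ y * f y) =ᶠ[𝓝 y] fun _ ↦ 0 := by
        filter_upwards [hC'.isClosed.isOpen_compl.mem_nhds fun h ↦ hy (hC'U h)] with z hz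
          using hg0 z hz
      exact contDiffAt_const.congr_of_eventuallyEq this
  · filter_upwards [(eventually_nhdsSet_iff_forall.1 hχ1) y hy] with z hz
    simp [hz]

namespace IsMetricOn

variable {G : Euc n → Matrix (Fin n) (Fin n) ℝ} {U C : Set (Euc n)} (hG : IsMetricOn G U)
  {f w : Euc n → ℝ} {K : ℝ}

include hG

/-- Joint continuity in the point and the derivatives serves twice in the passage to the limit: it
gives pointwise convergence of the integrands and, on compact sets of jets, a uniform bound. -/
lemma continuousOn_bochnerJet (hw : ∀ y ∈ U, ContDiffAt ℝ 2 w y) :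
    ContinuousOn (bochnerJet G K w) (U ×ˢ Set.univ) := by
  have hfst {φ : Euc n → ℝ} (h : ContinuousOn φ U) : ContinuousOn
      (fun x : Euc n × (Fin n → ℝ) × (Fin n → Fin n → ℝ) ↦ φ x.1) (U ×ˢ Set.univ) :=
    h.comp continuous_fst.continuousOn fun x hx ↦ hx.1
  have ha (i j : Fin n) := hfst (φ := fun z ↦ (G z)⁻¹ i j) fun y hy ↦
    (hG.contDiffAt_inv hy i j).continuousAt.continuousWithinAt
  have hΓ (k i j : Fin n) := hfst (φ := christoffel G k i j) fun y hy ↦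
    (hG.contDiffAt_christoffel hy k i j).continuousAt.continuousWithinAt
  have hw' := hfst (φ := w) fun y hy ↦ (hw y hy).continuousAt.continuousWithinAt
  have hgw (i : Fin n) := hfst (φ := grad G w i) fun y hy ↦
    (hG.contDiffAt_grad (m := 0) hy (hw y hy) (by norm_num) (by simp) i).continuousAt.continuousWithinAt
  have hLw := hfst (hG.continuousOn_laplacian hw)
  have hp (i : Fin n) : ContinuousOn
      (fun x : Euc n × (Fin n → ℝ) × (Fin n → Fin n → ℝ) ↦ x.2.1 i) (U ×ˢ Set.univ) := by
    fun_prop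
  have hA (i j : Fin n) : ContinuousOn
      (fun x : Euc n × (Fin n → ℝ) × (Fin n → Fin n → ℝ) ↦ x.2.2 i j) (U ×ˢ Set.univ) := by
    fun_prop
  have hE := continuousOn_finsetSum Finset.univ fun i _ ↦ (hp i).mul
    (continuousOn_finsetSum Finset.univ fun j _ ↦ (ha i j).mul (hp j))
  have hL := continuousOn_finsetSum Finset.univ fun i _ ↦
    continuousOn_finsetSum Finset.univ fun j _ ↦ (ha i j).mul ((hA i j).sub
      (continuousOn_finsetSum Finset.univ fun k _ ↦ (hΓ k i j).mul (hp k)))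
  have hW := continuousOn_finsetSum Finset.univ fun i _ ↦ (hp i).mul (hgw i)
  exact (((hE.mul hLw).div_const 2).add (hL.mul hW)).add
    (hw'.mul ((hL.pow 2).sub ((hL.pow 2).div_const _))) |>.sub
      ((continuousOn_const.mul hw').mul hE)

/-- The weighted Bochner integral passes to limits of functions whose first and second derivatives
converge boundedly. -/
lemma tendsto_integral_bochnerIntegrand (hC : IsCompact C) (hCU : C ⊆ U)
    (hw : ∀ y ∈ U, ContDiffAt ℝ 2 w y) (h0 : ∀ y ∉ C, w y = 0) {F : ℕ → Euc n → ℝ} {B : ℝ}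
    (hB : 0 ≤ B) (hF : ∀ k, ContDiff ℝ 2 (F k))
    (hF1 : ∀ i y, Tendsto (fun k ↦ partialDeriv i (F k) y) atTop (𝓝 (partialDeriv i f y)))
    (hF2 : ∀ i j y, Tendsto (fun k ↦ partialDeriv i (partialDeriv j (F k)) y) atTop
      (𝓝 (partialDeriv i (partialDeriv j f) y)))
    (hb1 : ∀ k i y, |partialDeriv i (F k) y| ≤ B)
    (hb2 : ∀ k i j y, |partialDeriv i (partialDeriv j (F k)) y| ≤ B) :
    Tendsto (fun k ↦ ∫ y in U, bochnerIntegrand G K w (F k) y * volDensity G y) atTop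
      (𝓝 (∫ y in U, bochnerIntegrand G K w f y * volDensity G y)) := by
  have hJ := hG.continuousOn_bochnerJet (K := K) hw
  -- All jets of the approximants over C lie in one compact set: function spaces carry the sup norm,
  -- so coordinatewise bounds by B mean membership in these balls. Thus M√det G on C dominates.
  obtain ⟨M, hM⟩ := (hC.prod ((isCompact_closedBall (0 : Fin n → ℝ) B).prod
    (isCompact_closedBall (0 : Fin n → Fin n → ℝ) B))).exists_bound_of_continuousOn
      (hJ.mono (Set.prod_mono hCU (Set.subset_univ _)))
  have hcont (k : ℕ) : ContinuousOn
      (fun y ↦ bochnerIntegrand G K w (F k) y * volDensity G y) U := by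
    have hp (j : Fin n) : ContDiff ℝ 1 (partialDeriv j (F k)) := contDiff_iff_contDiffAt.2 fun y ↦
      contDiffAt_partialDeriv (hF k).contDiffAt (by norm_num) j
    refine ContinuousOn.mul (hJ.comp (f := fun y ↦ (y, (fun i ↦ partialDeriv i (F k) y),
      fun i j ↦ partialDeriv i (partialDeriv j (F k)) y)) (Continuous.continuousOn ?_)
        fun y hy ↦ ⟨hy, trivial⟩) hG.continuousOn_volDensity
    exact continuous_id.prodMk ((continuous_pi fun i ↦ (hp i).continuous).prodMk
      (continuous_pi fun i ↦ continuous_pi fun j ↦ continuous_partialDeriv (hp j) i))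
  have hcb : ContinuousOn (fun y ↦ M * volDensity G y) C :=
    continuousOn_const.mul (hG.continuousOn_volDensity.mono hCU)
  refine tendsto_integral_of_dominated_convergence
    (fun y ↦ C.indicator (fun y ↦ M * volDensity G y) y)
    (fun k ↦ (hcont k).aestronglyMeasurable hG.isOpen.measurableSet) ?_ (fun k ↦ ?_) ?_
  · exact ((integrable_indicator_iff hC.measurableSet).2
      (hcb.integrableOn_compact hC)).mono_measure Measure.restrict_le_self
  · filter_upwards [ae_restrict_mem hG.isOpen.measurableSet] with y hy
    by_cases hyC : y ∈ C
    · rw [Set.indicator_of_mem hyC, norm_mul, Real.norm_of_nonneg (hG.volDensity_pos hy).le]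
      refine mul_le_mul_of_nonneg_right ?_ (hG.volDensity_pos hy).le
      rw [bochnerIntegrand_eq_jet]
      refine hM _ ⟨hyC, ?_, ?_⟩
      · rw [mem_closedBall_zero_iff, pi_norm_le_iff_of_nonneg hB]
        exact fun i ↦ hb1 k i y
      · rw [mem_closedBall_zero_iff, pi_norm_le_iff_of_nonneg hB]
        intro i
        rw [pi_norm_le_iff_of_nonneg hB]
        exact fun j ↦ hb2 k i j y
    · rw [bochnerIntegrand_eq_zero_of_notMem hC h0 hyC, Set.indicator_of_notMem hyC]
      simp
  · filter_upwards [ae_restrict_mem hG.isOpen.measurableSet] with y hy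
    refine Tendsto.mul_const _ ?_
    simp only [bochnerIntegrand_eq_jet]
    refine ((hJ.continuousAt
      ((hG.isOpen.prod isOpen_univ).mem_nhds ⟨hy, trivial⟩)).tendsto).comp ?_
    exact tendsto_const_nhds.prodMk_nhds ((tendsto_pi_nhds.2 fun i ↦ hF1 i y).prodMk_nhds
      (tendsto_pi_nhds.2 fun i ↦ tendsto_pi_nhds.2 fun j ↦ hF2 i j y))

/-- The weighted Bochner inequality for `C²` functions. -/
theorem integral_bochnerIntegrand_nonneg (hC : IsCompact C) (hCU : C ⊆ U)
    (hCD : ∀ f : Euc n → ℝ, ∀ y ∈ U, ContDiff ℝ ∞ f →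
      laplacian G f y ^ 2 / n + K * gradInner G f f y
        ≤ laplacian G (gradInner G f f) y / 2 - gradInner G f (laplacian G f) y)
    (hf : ∀ y ∈ U, ContDiffAt ℝ 2 f y) (hw : ∀ y ∈ U, ContDiffAt ℝ 2 w y)
    (hw0 : ∀ y ∈ U, 0 ≤ w y) (h0 : ∀ y ∉ C, w y = 0) :
    0 ≤ ∫ y in U, bochnerIntegrand G K w f y * volDensity G y := by
  -- Outside C the integrand vanishes with w, so f may be replaced by a compactly supported C²
  -- function agreeing with it near C, which can be mollified.
  obtain ⟨g, hg, hgc, hgf⟩ := exists_contDiff_hasCompactSupport_eq hC hG.isOpen hCU hf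
  have hfg : ∀ y ∈ U, bochnerIntegrand G K w f y * volDensity G y
      = bochnerIntegrand G K w g y * volDensity G y := fun y _ ↦ by
    by_cases hyC : y ∈ C
    · have e := hgf y hyC
      simp only [bochnerIntegrand_eq_jet, partialDeriv_congr _ e,
        partialDeriv_congr _ (partialDeriv_eventuallyEq _ e)]
    · rw [bochnerIntegrand_eq_zero_of_notMem hC h0 hyC,
        bochnerIntegrand_eq_zero_of_notMem hC h0 hyC]
  rw [setIntegral_congr_fun hG.isOpen.measurableSet hfg]
  obtain ⟨F, B, hB, hFs, hF1, hF2, hb1, hb2⟩ := exists_contDiff_approx hg hgc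
  have hpos (k : ℕ) : 0 ≤ ∫ y in U, bochnerIntegrand G K w (F k) y * volDensity G y :=
    hG.integral_bochnerIntegrand_nonneg_of_contDiff hC hCU (fun y hy ↦ hCD _ y hy (hFs k))
      (fun y _ ↦ (hFs k).contDiffAt.of_le ENat.LEInfty.out) hw hw0 h0
  exact ge_of_tendsto' (hG.tendsto_integral_bochnerIntegrand hC hCU hw h0 hB
    (fun k ↦ (hFs k).of_le ENat.LEInfty.out) hF1 hF2 hb1 hb2) hpos

end IsMetricOn

end LocalGeometry

/-! ### The metric and the transition maps in charts. -/

namespace SmoothMetric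

open Filter Topology Matrix MeasureTheory LocalGeometry

variable {n : ℕ} {M : Type*} [TopologicalSpace M]
  [ChartedSpace (EuclideanSpace ℝ (Fin n)) M] [IsManifold (𝓡 n) ∞ M]

/-- The scalar product at `x`, on the model space of the tangent space. -/
noncomputable def modelInner (m : SmoothMetric n M) (x : M) : Euc n →L[ℝ] Euc n →L[ℝ] ℝ :=
  m.inner x

/-- The derivative of the inverse of the chart around `p`, on the model space. -/
noncomputable def chartDeriv (p : M) (y : Euc n) : Euc n →L[ℝ] Euc n :=
  mfderiv 𝓘(ℝ, Euc n) (𝓡 n) (extChartAt (𝓡 n) p).symm y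

lemma inChart_apply (m : SmoothMetric n M) (p : M) (y : Euc n) (i j : Fin n) :
    m.inChart p y i j = m.modelInner ((extChartAt (𝓡 n) p).symm y)
      (chartDeriv p y (EuclideanSpace.single i 1)) (chartDeriv p y (EuclideanSpace.single j 1)) :=
  rfl

lemma sum_inChart (m : SmoothMetric n M) (p : M) (y v w : Euc n) :
    ∑ i, ∑ j, m.inChart p y i j * v i * w j
      = m.modelInner ((extChartAt (𝓡 n) p).symm y) (chartDeriv p y v) (chartDeriv p y w) := by
  have hv (v : Euc n) : v = ∑ i, v i • (EuclideanSpace.single i (1 : ℝ) : Euc n) := by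
    simpa using ((EuclideanSpace.basisFun (Fin n) ℝ).sum_repr v).symm
  conv_rhs => rw [hv v, hv w]
  simp only [map_sum, map_smul, _root_.sum_apply, _root_.smul_apply,
    smul_eq_mul, inChart_apply, Finset.mul_sum]
  rw [Finset.sum_comm]
  exact Finset.sum_congr rfl fun i _ ↦ Finset.sum_congr rfl fun j _ ↦ by ring

lemma isInvertible_chartDeriv {p : M} {y : Euc n} (hy : y ∈ (extChartAt (𝓡 n) p).target) :
    (chartDeriv p y).IsInvertible := by
  have := isInvertible_mfderivWithin_extChartAt_symm (I := 𝓡 n) hy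
  rw [ModelWithCorners.range_eq_univ, mfderivWithin_univ] at this
  exact this

lemma mdifferentiableAt_symm {p : M} {y : Euc n} (hy : y ∈ (extChartAt (𝓡 n) p).target) :
    MDifferentiableAt 𝓘(ℝ, Euc n) (𝓡 n) (extChartAt (𝓡 n) p).symm y := by
  have := mdifferentiableWithinAt_extChartAt_symm (I := 𝓡 n) hy
  rwa [ModelWithCorners.range_eq_univ, mdifferentiableWithinAt_univ] at this

lemma contMDiffAt_symm {p : M} {y : Euc n} (hy : y ∈ (extChartAt (𝓡 n) p).target) :
    ContMDiffAt 𝓘(ℝ, Euc n) (𝓡 n) ∞ (extChartAt (𝓡 n) p).symm y :=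
  (contMDiffOn_extChartAt_symm p).contMDiffAt ((isOpen_extChartAt_target p).mem_nhds hy)

lemma contMDiffAt_extChartAt_of_mem {p x : M} (hx : x ∈ (extChartAt (𝓡 n) p).source) :
    ContMDiffAt (𝓡 n) 𝓘(ℝ, Euc n) ∞ (extChartAt (𝓡 n) p) x :=
  contMDiffAt_extChartAt' (by rwa [extChartAt_source] at hx)

/-- The coordinate fields are the tangent map of the inverse chart applied to constant sections,
hence smooth along the inverse chart; pairing two of them with the smooth bundle metric gives a
smooth function. -/
lemma contDiffAt_inChart (m : SmoothMetric n M) {p : M} {y : Euc n}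
    (hy : y ∈ (extChartAt (𝓡 n) p).target) (i j : Fin n) :
    ContDiffAt ℝ ∞ (fun z ↦ m.inChart p z i j) y := by
  have hopen : IsOpen (extChartAt (𝓡 n) p).target := isOpen_extChartAt_target p
  have hsec (i : Fin n) : ContMDiffAt 𝓘(ℝ, Euc n) ((𝓡 n).prod 𝓘(ℝ, Euc n)) ∞
      (fun z ↦ Bundle.TotalSpace.mk' (Euc n) (E := fun x : M ↦ TangentSpace (𝓡 n) x)
        ((extChartAt (𝓡 n) p).symm z) (coordVec p z i)) y := by
    have h1 := (contMDiffOn_extChartAt_symm (I := 𝓡 n) (n := ∞) p).contMDiffOn_tangentMapWithin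
      (m := ∞) (by simp) hopen.uniqueMDiffOn
    have h2 := contMDiff_vectorSpace_iff_contDiff.2 (contDiff_const (𝕜 := ℝ) (n := ∞) (E := Euc n)
      (c := (EuclideanSpace.single i (1 : ℝ) : Euc n)))
    have h3 := h1.comp (s := (extChartAt (𝓡 n) p).target) h2.contMDiffOn fun z hz ↦ hz
    refine (h3.contMDiffAt (hopen.mem_nhds hy)).congr_of_eventuallyEq ?_
    filter_upwards [hopen.mem_nhds hy] with z hz
    simp only [Function.comp_apply, tangentMapWithin, mfderivWithin_of_isOpen hopen hz]
    rfl
  have hb : ContMDiffAt 𝓘(ℝ, Euc n) (𝓡 n) ∞ (extChartAt (𝓡 n) p).symm y := contMDiffAt_symm hy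
  have : ContMDiffAt 𝓘(ℝ, Euc n) ((𝓡 n).prod 𝓘(ℝ)) ∞
      (fun z ↦ Bundle.TotalSpace.mk' ℝ (E := Bundle.Trivial M ℝ) ((extChartAt (𝓡 n) p).symm z)
        (m.inner ((extChartAt (𝓡 n) p).symm z) (coordVec p z i) (coordVec p z j))) y := by
    apply ContMDiffAt.clm_bundle_apply₂ (F₁ := Euc n) (F₂ := Euc n)
    · exact ContMDiffAt.comp y m.contMDiff.contMDiffAt hb
    · exact hsec i
    · exact hsec j
  simp only [Bundle.contMDiffAt_totalSpace] at this
  exact this.2.contDiffAt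

/-- In the chart around `p`, the metric is a smooth Riemannian metric on an open set. -/
lemma isMetricOn_inChart (m : SmoothMetric n M) (p : M) :
    IsMetricOn (m.inChart p) (extChartAt (𝓡 n) p).target where
  isOpen := isOpen_extChartAt_target p
  contDiffAt _ hy i j := m.contDiffAt_inChart hy i j
  posDef y hy := by
    refine Matrix.PosDef.of_dotProduct_mulVec_pos ?_ fun v hv ↦ ?_
    · ext i j
      exact (star_trivial _).trans (m.symm _ _ _)
    · have h1 := m.sum_inChart p y (WithLp.toLp 2 v) (WithLp.toLp 2 v)
      have h2 : star v ⬝ᵥ (m.inChart p y *ᵥ v)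
          = ∑ i, ∑ j, m.inChart p y i j * v i * v j := by
        simp only [dotProduct, Matrix.mulVec, Finset.mul_sum, star_trivial]
        exact Finset.sum_congr rfl fun i _ ↦ Finset.sum_congr rfl fun j _ ↦ by ring
      rw [h2]
      refine lt_of_lt_of_eq ?_ h1.symm
      refine m.pos _ _ fun h0 ↦ hv ?_
      have := (isInvertible_chartDeriv hy).injective (h0.trans (map_zero (chartDeriv p y)).symm)
      simpa using this

/-! ### Change of charts -/

/-- The coordinate change from the chart around `p` to the chart around `q`. -/
noncomputable def transition (p q : M) : Euc n → Euc n :=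
  extChartAt (𝓡 n) q ∘ (extChartAt (𝓡 n) p).symm

section Transition

variable {p q : M} {y : Euc n} (hy : y ∈ (extChartAt (𝓡 n) p).target)
  (hyq : (extChartAt (𝓡 n) p).symm y ∈ (extChartAt (𝓡 n) q).source)

include hy hyq

lemma contDiffAt_transition : ContDiffAt ℝ ∞ (transition p q) y :=
  ((contMDiffAt_extChartAt_of_mem hyq).comp y (contMDiffAt_symm hy)).contDiffAt

omit [IsManifold (𝓡 n) ∞ M] hy in
lemma transition_mem_target : transition p q y ∈ (extChartAt (𝓡 n) q).target :=
  (extChartAt (𝓡 n) q).map_source hyq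

omit [IsManifold (𝓡 n) ∞ M] hy in
lemma symm_transition :
    (extChartAt (𝓡 n) q).symm (transition p q y) = (extChartAt (𝓡 n) p).symm y :=
  (extChartAt (𝓡 n) q).left_inv hyq

lemma eventually_mem_overlap : ∀ᶠ z in 𝓝 y, z ∈ (extChartAt (𝓡 n) p).target ∧
    (extChartAt (𝓡 n) p).symm z ∈ (extChartAt (𝓡 n) q).source := by
  filter_upwards [(isOpen_extChartAt_target p).mem_nhds hy,
    (contMDiffAt_symm hy).continuousAt ((isOpen_extChartAt_source q).mem_nhds hyq)] with z h1 h2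
    using ⟨h1, h2⟩

lemma chartDeriv_eq_comp :
    chartDeriv p y = (chartDeriv q (transition p q y)).comp (fderiv ℝ (transition p q) y) := by
  have e : (extChartAt (𝓡 n) p).symm =ᶠ[𝓝 y] (extChartAt (𝓡 n) q).symm ∘ transition p q := by
    filter_upwards [eventually_mem_overlap hy hyq] with z hz using (symm_transition hz.2).symm
  have h1 := (mdifferentiableAt_symm (transition_mem_target hyq)).hasMFDerivAt.comp y
    ((contDiffAt_transition hy hyq).differentiableAt (by simp)).hasFDerivAt.hasMFDerivAt
  have h2 := (h1.congr_of_eventuallyEq e).mfderiv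
  exact h2

/-- Links the manifold to the local theory: this is the relation G = Jᵀ G'(τ) J that the invariance
results take as hypothesis, with τ the transition map. -/
lemma inChart_eq_transition (m : SmoothMetric n M) :
    m.inChart p y = (jacobian (transition p q) y)ᵀ * m.inChart q (transition p q y)
      * jacobian (transition p q) y := by
  have hd : DifferentiableAt ℝ (transition p q) y :=
    (contDiffAt_transition hy hyq).differentiableAt (by simp)
  have hJ (a i : Fin n) : fderiv ℝ (transition p q) y (EuclideanSpace.single i 1) a
      = jacobian (transition p q) y a i := by
    rw [fderiv_apply_eq_jacobian hd]; simp
  ext i j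
  rw [inChart_apply, chartDeriv_eq_comp hy hyq, ← symm_transition hyq]
  simp only [ContinuousLinearMap.comp_apply]
  rw [← m.sum_inChart q]
  simp only [hJ, Matrix.mul_apply, Matrix.transpose_apply, Finset.sum_mul]
  rw [Finset.sum_comm]
  exact Finset.sum_congr rfl fun b _ ↦ Finset.sum_congr rfl fun a _ ↦ by ring

lemma eventually_inChart_eq_transition (m : SmoothMetric n M) :
    ∀ᶠ z in 𝓝 y, m.inChart p z = (jacobian (transition p q) z)ᵀ
      * m.inChart q (transition p q z) * jacobian (transition p q) z := by
  filter_upwards [eventually_mem_overlap hy hyq] with z hz using inChart_eq_transition hz.1 hz.2 m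

end Transition

end SmoothMetric

/-! ### Additivity, and invariance of gradient products and of the curvature term. -/

namespace LocalGeometry

open Filter Topology Matrix

variable {n : ℕ} {G G' : Euc n → Matrix (Fin n) (Fin n) ℝ} {U U' : Set (Euc n)} {y : Euc n}
  {f h : Euc n → ℝ}

lemma laplacian_sum {ι : Type*} (s : Finset ι) {F : ι → Euc n → ℝ}
    (hF : ∀ a ∈ s, ContDiffAt ℝ 2 (F a) y) :
    laplacian G (fun z ↦ ∑ a ∈ s, F a z) y = ∑ a ∈ s, laplacian G (F a) y := by
  have hev : ∀ᶠ z in 𝓝 y, ∀ a ∈ s, DifferentiableAt ℝ (F a) z := by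
    rw [Finset.eventually_all]
    exact fun a ha ↦ ((hF a ha).eventually (by simp)).mono fun z hz ↦
      hz.differentiableAt (by norm_num)
  have d1 (j : Fin n) : ∀ a ∈ s, DifferentiableAt ℝ (partialDeriv j (F a)) y := fun a ha ↦
    (contDiffAt_partialDeriv (m := 1) (hF a ha) (by norm_num) j).differentiableAt (by norm_num)
  have hH (i j : Fin n) : hessian G (fun z ↦ ∑ a ∈ s, F a z) i j y
      = ∑ a ∈ s, hessian G (F a) i j y := by
    unfold hessian
    rw [partialDeriv_congr i (hev.mono fun z hz ↦ partialDeriv_sum s j hz),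
      partialDeriv_sum s i (d1 j)]
    simp only [partialDeriv_sum s _ hev.self_of_nhds, Finset.sum_sub_distrib, Finset.mul_sum]
    rw [Finset.sum_comm]
  simp only [laplacian, hH, Finset.mul_sum]
  rw [Finset.sum_comm, Finset.sum_congr rfl fun i _ ↦ Finset.sum_comm, Finset.sum_comm]
  exact Finset.sum_congr rfl fun a _ ↦ Finset.sum_comm

lemma gradInner_congr_right (e : f =ᶠ[𝓝 y] h) (u : Euc n → ℝ) :
    gradInner G u f y = gradInner G u h y := by
  simp only [gradInner, grad, partialDeriv_congr _ e]

lemma gradInner_congr_left (e : f =ᶠ[𝓝 y] h) (u : Euc n → ℝ) :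
    gradInner G f u y = gradInner G h u y := by
  simp only [gradInner, partialDeriv_congr _ e]

lemma gradInner_sum_right {ι : Type*} (s : Finset ι) {F : ι → Euc n → ℝ}
    (hF : ∀ a ∈ s, DifferentiableAt ℝ (F a) y) (u : Euc n → ℝ) :
    gradInner G u (fun z ↦ ∑ a ∈ s, F a z) y = ∑ a ∈ s, gradInner G u (F a) y := by
  simp only [gradInner, grad, partialDeriv_sum s _ hF, Finset.mul_sum]
  rw [Finset.sum_congr rfl fun i _ ↦ Finset.sum_comm, Finset.sum_comm]

namespace IsMetricOn

variable (hG : IsMetricOn G U) (hy : y ∈ U) {τ : Euc n → Euc n} (hG' : IsMetricOn G' U')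
  (hτy : τ y ∈ U') (hτ : ContDiffAt ℝ 2 τ y)
  (hGG' : ∀ᶠ z in 𝓝 y, G z = (jacobian τ z)ᵀ * G' (τ z) * jacobian τ z)

include hG hy hG' hτy hτ hGG'

/-- The inner product of gradients does not depend on the coordinates. -/
lemma gradInner_comp (hf : ContDiffAt ℝ 2 f (τ y)) (hh : ContDiffAt ℝ 2 h (τ y)) :
    gradInner G (fun z ↦ f (τ z)) (fun z ↦ h (τ z)) y = gradInner G' f h (τ y) := by
  -- Polarization: 2⟨∇f, ∇h⟩ = Δ(fh) - fΔh - hΔf, so invariance follows from that of the Laplacian.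
  -- The price is the C² hypothesis on f and h, and therefore four derivatives of f in
  -- `curvatureTerm_comp`.
  have h1 := hG.laplacian_mul hy (hf.comp y hτ) (hh.comp y hτ)
  have h2 := hG'.laplacian_mul hτy hf hh
  have h3 := hG.laplacian_comp hy hG' hτy hτ hGG' (hf.mul hh)
  have h4 := hG.laplacian_comp hy hG' hτy hτ hGG' hf
  have h5 := hG.laplacian_comp hy hG' hτy hτ hGG' hh
  simp only [Function.comp_def] at h1
  rw [h4, h5] at h1
  rw [h1, h2] at h3
  linarith

/-- The iterated carré du champ operator does not depend on the coordinates. -/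
lemma curvatureTerm_comp (hf : ContDiffAt ℝ 4 f (τ y)) :
    laplacian G (gradInner G (fun z ↦ f (τ z)) (fun z ↦ f (τ z))) y / 2
        - gradInner G (fun z ↦ f (τ z)) (laplacian G (fun z ↦ f (τ z))) y
      = laplacian G' (gradInner G' f f) (τ y) / 2 - gradInner G' f (laplacian G' f) (τ y) := by
  have hf2 : ContDiffAt ℝ 2 f (τ y) := hf.of_le (by norm_num)
  have hev : ∀ᶠ z in 𝓝 y, z ∈ U ∧ τ z ∈ U' ∧ ContDiffAt ℝ 2 τ z ∧ ContDiffAt ℝ 2 f (τ z) ∧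
      ∀ᶠ z' in 𝓝 z, G z' = (jacobian τ z')ᵀ * G' (τ z') * jacobian τ z' := by
    filter_upwards [hG.mem_nhds hy, hτ.continuousAt (hG'.mem_nhds hτy), hτ.eventually (by simp),
      hτ.continuousAt.eventually (hf2.eventually (by simp)), hGG'.eventually_nhds]
      with z h1 h2 h3 h4 h5 using ⟨h1, h2, h3, h4, h5⟩
  have e1 : gradInner G (fun z ↦ f (τ z)) (fun z ↦ f (τ z)) =ᶠ[𝓝 y]
      fun z ↦ gradInner G' f f (τ z) := hev.mono fun z ⟨h1, h2, h3, h4, h5⟩ ↦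
    hG.gradInner_comp h1 hG' h2 h3 h5 h4 h4
  have e2 : laplacian G (fun z ↦ f (τ z)) =ᶠ[𝓝 y] fun z ↦ laplacian G' f (τ z) :=
    hev.mono fun z ⟨h1, h2, h3, h4, h5⟩ ↦ hG.laplacian_comp h1 hG' h2 h3 h5 h4
  rw [laplacian_congr e1, gradInner_congr_right e2,
    hG.laplacian_comp hy hG' hτy hτ hGG' (hG'.contDiffAt_gradInner hτy hf hf (by norm_num)
      ENat.LEInfty.out),
    hG.gradInner_comp hy hG' hτy hτ hGG' hf2 (hG'.contDiffAt_laplacian hτy hf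
      (by norm_num) ENat.LEInfty.out)]

end IsMetricOn

end LocalGeometry

/-! ### Laplacian and gradient products on the manifold. -/

namespace SmoothMetric

open Filter Topology Matrix MeasureTheory LocalGeometry

variable {n : ℕ} {M : Type*} [TopologicalSpace M]
  [ChartedSpace (EuclideanSpace ℝ (Fin n)) M] [IsManifold (𝓡 n) ∞ M]

/-- A function on `M` in the coordinates of the chart around `p`. -/
noncomputable def read (p : M) (u : M → ℝ) : Euc n → ℝ := u ∘ (extChartAt (𝓡 n) p).symm

/-- The inner product `⟨∇u, ∇w⟩` at `x`, computed in the chart around `x`. -/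
noncomputable def gradInner (m : SmoothMetric n M) (u w : M → ℝ) (x : M) : ℝ :=
  LocalGeometry.gradInner (m.inChart x) (read x u) (read x w) (extChartAt (𝓡 n) x x)

lemma contDiffAt_read {k : WithTop ℕ∞} (hk : k ≤ ∞) {p : M} {u : M → ℝ} {y : Euc n}
    (hy : y ∈ (extChartAt (𝓡 n) p).target)
    (hu : ContMDiffAt (𝓡 n) 𝓘(ℝ, ℝ) k u ((extChartAt (𝓡 n) p).symm y)) :
    ContDiffAt ℝ k (read p u) y :=
  (hu.comp y ((contMDiffAt_symm hy).of_le hk)).contDiffAt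

lemma read_eventuallyEq {p q : M} {y : Euc n} (hy : y ∈ (extChartAt (𝓡 n) p).target)
    (hyq : (extChartAt (𝓡 n) p).symm y ∈ (extChartAt (𝓡 n) q).source) (u : M → ℝ) :
    read p u =ᶠ[𝓝 y] fun z ↦ read q u (transition p q z) := by
  filter_upwards [eventually_mem_overlap hy hyq] with z hz
  simp only [read, Function.comp_apply, symm_transition hz.2]

section Charts

variable (m : SmoothMetric n M) {p x : M} (hx : x ∈ (extChartAt (𝓡 n) p).source) {u w : M → ℝ}

include hx

omit [IsManifold (𝓡 n) ∞ M] in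
lemma transition_apply_self : transition p x (extChartAt (𝓡 n) p x) = extChartAt (𝓡 n) x x := by
  simp only [transition, Function.comp_apply, (extChartAt (𝓡 n) p).left_inv hx]

/-- The Laplacian may be computed in any chart. -/
lemma laplacian_eq_chart (hu : ContMDiffAt (𝓡 n) 𝓘(ℝ, ℝ) 2 u x) :
    m.laplacian u x
      = LocalGeometry.laplacian (m.inChart p) (read p u) (extChartAt (𝓡 n) p x) := by
  have hy := (extChartAt (𝓡 n) p).map_source hx
  have hl := (extChartAt (𝓡 n) p).left_inv hx
  have hyq : (extChartAt (𝓡 n) p).symm (extChartAt (𝓡 n) p x) ∈ (extChartAt (𝓡 n) x).source := by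
    rw [hl]; exact mem_extChartAt_source x
  have hself : (extChartAt (𝓡 n) x).symm (extChartAt (𝓡 n) x x) = x :=
    (extChartAt (𝓡 n) x).left_inv (mem_extChartAt_source x)
  have ht := transition_apply_self hx
  have hf : ContDiffAt ℝ 2 (read x u) (transition p x (extChartAt (𝓡 n) p x)) := by
    rw [ht]
    exact contDiffAt_read ENat.LEInfty.out (mem_extChartAt_target x) (by rwa [hself])
  rw [laplacian_congr (read_eventuallyEq hy hyq u),
    (m.isMetricOn_inChart p).laplacian_comp hy (m.isMetricOn_inChart x)
      (transition_mem_target hyq) ((contDiffAt_transition hy hyq).of_le ENat.LEInfty.out)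
      (eventually_inChart_eq_transition hy hyq m) hf, ht]
  rfl

/-- The inner product of gradients may be computed in any chart. -/
lemma gradInner_eq_chart (hu : ContMDiffAt (𝓡 n) 𝓘(ℝ, ℝ) 2 u x)
    (hw : ContMDiffAt (𝓡 n) 𝓘(ℝ, ℝ) 2 w x) :
    m.gradInner u w x = LocalGeometry.gradInner (m.inChart p) (read p u) (read p w)
      (extChartAt (𝓡 n) p x) := by
  have hy := (extChartAt (𝓡 n) p).map_source hx
  have hl := (extChartAt (𝓡 n) p).left_inv hx
  have hyq : (extChartAt (𝓡 n) p).symm (extChartAt (𝓡 n) p x) ∈ (extChartAt (𝓡 n) x).source := by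
    rw [hl]; exact mem_extChartAt_source x
  have hself : (extChartAt (𝓡 n) x).symm (extChartAt (𝓡 n) x x) = x :=
    (extChartAt (𝓡 n) x).left_inv (mem_extChartAt_source x)
  have ht := transition_apply_self hx
  have hf (v : M → ℝ) (hv : ContMDiffAt (𝓡 n) 𝓘(ℝ, ℝ) 2 v x) :
      ContDiffAt ℝ 2 (read x v) (transition p x (extChartAt (𝓡 n) p x)) := by
    rw [ht]
    exact contDiffAt_read ENat.LEInfty.out (mem_extChartAt_target x) (by rwa [hself])
  rw [gradInner_congr_right (read_eventuallyEq hy hyq w),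
    gradInner_congr_left (read_eventuallyEq hy hyq u),
    (m.isMetricOn_inChart p).gradInner_comp hy (m.isMetricOn_inChart x)
      (transition_mem_target hyq) ((contDiffAt_transition hy hyq).of_le ENat.LEInfty.out)
      (eventually_inChart_eq_transition hy hyq m) (hf u hu) (hf w hw), ht]
  rfl

end Charts

section Global

variable (m : SmoothMetric n M) {u w : M → ℝ}

lemma contDiffAt_read_self {k : WithTop ℕ∞} (hk : k ≤ ∞) {x : M}
    (hu : ContMDiffAt (𝓡 n) 𝓘(ℝ, ℝ) k u x) :
    ContDiffAt ℝ k (read x u) (extChartAt (𝓡 n) x x) :=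
  contDiffAt_read hk (mem_extChartAt_target x)
    (by rwa [(extChartAt (𝓡 n) x).left_inv (mem_extChartAt_source x)])

/-- The definition uses a different chart at each point; continuity becomes visible only after
`laplacian_eq_chart` fixes one chart near x. -/
lemma continuous_laplacian (hu : ContMDiff (𝓡 n) 𝓘(ℝ, ℝ) 2 u) : Continuous (m.laplacian u) := by
  rw [continuous_iff_continuousAt]
  intro x
  have h1 : ContinuousAt (LocalGeometry.laplacian (m.inChart x) (read x u))
      (extChartAt (𝓡 n) x x) :=
    ((m.isMetricOn_inChart x).contDiffAt_laplacian (m := 0) (mem_extChartAt_target x)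
      (contDiffAt_read_self ENat.LEInfty.out (hu x)) (by norm_num) (by simp)).continuousAt
  refine (h1.comp (continuousAt_extChartAt x)).congr ?_
  filter_upwards [extChartAt_source_mem_nhds (I := 𝓡 n) x] with z hz
    using (m.laplacian_eq_chart hz (hu z)).symm

lemma continuous_gradInner (hu : ContMDiff (𝓡 n) 𝓘(ℝ, ℝ) 2 u)
    (hw : ContMDiff (𝓡 n) 𝓘(ℝ, ℝ) 2 w) : Continuous (m.gradInner u w) := by
  rw [continuous_iff_continuousAt]
  intro x
  have h1 : ContinuousAt (LocalGeometry.gradInner (m.inChart x) (read x u) (read x w))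
      (extChartAt (𝓡 n) x x) :=
    ((m.isMetricOn_inChart x).contDiffAt_gradInner (m := 0) (mem_extChartAt_target x)
      (contDiffAt_read_self ENat.LEInfty.out (hu x))
      (contDiffAt_read_self ENat.LEInfty.out (hw x)) (by norm_num) (by simp)).continuousAt
  refine (h1.comp (continuousAt_extChartAt x)).congr ?_
  filter_upwards [extChartAt_source_mem_nhds (I := 𝓡 n) x] with z hz
    using (m.gradInner_eq_chart hz (hu z) (hw z)).symm

lemma laplacian_fun_sum {ι : Type*} (s : Finset ι) {F : ι → M → ℝ}
    (hF : ∀ a ∈ s, ContMDiff (𝓡 n) 𝓘(ℝ, ℝ) 2 (F a)) (x : M) :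
    m.laplacian (fun z ↦ ∑ a ∈ s, F a z) x = ∑ a ∈ s, m.laplacian (F a) x :=
  LocalGeometry.laplacian_sum s fun a ha ↦ contDiffAt_read_self ENat.LEInfty.out (hF a ha x)

lemma gradInner_fun_sum {ι : Type*} (s : Finset ι) {F : ι → M → ℝ}
    (hF : ∀ a ∈ s, ContMDiff (𝓡 n) 𝓘(ℝ, ℝ) 2 (F a)) (x : M) :
    m.gradInner u (fun z ↦ ∑ a ∈ s, F a z) x = ∑ a ∈ s, m.gradInner u (F a) x :=
  LocalGeometry.gradInner_sum_right s (fun a ha ↦ (contDiffAt_read_self (k := 2)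
    ENat.LEInfty.out (hF a ha x)).differentiableAt (by norm_num)) _

lemma laplacian_comp_real {H H' : ℝ → ℝ} {H'' : ℝ} {x : M} (hH : ∀ t, HasDerivAt H (H' t) t)
    (hH' : HasDerivAt H' H'' (u x)) (hu : ContMDiffAt (𝓡 n) 𝓘(ℝ, ℝ) 2 u x) :
    m.laplacian (fun z ↦ H (u z)) x = H' (u x) * m.laplacian u x + H'' * m.gradInner u u x := by
  have hx : read x u (extChartAt (𝓡 n) x x) = u x := by
    simp only [read, Function.comp_apply, (extChartAt (𝓡 n) x).left_inv (mem_extChartAt_source x)]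
  have := LocalGeometry.laplacian_comp_real (G := m.inChart x) hH (by rw [hx]; exact hH')
    (contDiffAt_read_self ENat.LEInfty.out hu)
  rw [hx] at this
  exact this

/-- A lower bound on the Ricci curvature implies the curvature-dimension inequality in every
chart. -/
lemma curvatureDimension_inChart {K : ℝ} (hRic : m.RicciBoundedBelow K) (p : M)
    (f : Euc n → ℝ) (y : Euc n) (hy : y ∈ (extChartAt (𝓡 n) p).target) (hf : ContDiff ℝ ∞ f) :
    LocalGeometry.laplacian (m.inChart p) f y ^ 2 / n
        + K * LocalGeometry.gradInner (m.inChart p) f f y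
      ≤ LocalGeometry.laplacian (m.inChart p) (LocalGeometry.gradInner (m.inChart p) f f) y / 2
        - LocalGeometry.gradInner (m.inChart p) f (LocalGeometry.laplacian (m.inChart p) f) y := by
  set x := (extChartAt (𝓡 n) p).symm y
  have hxp : x ∈ (extChartAt (𝓡 n) p).source := (extChartAt (𝓡 n) p).map_target hy
  have hself : (extChartAt (𝓡 n) x).symm (extChartAt (𝓡 n) x x) = x :=
    (extChartAt (𝓡 n) x).left_inv (mem_extChartAt_source x)
  have hx := mem_extChartAt_target (I := 𝓡 n) x
  have hxq : (extChartAt (𝓡 n) x).symm (extChartAt (𝓡 n) x x) ∈ (extChartAt (𝓡 n) p).source := by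
    rwa [hself]
  have ht : transition x p (extChartAt (𝓡 n) x x) = y := by
    simp only [transition, Function.comp_apply, hself]
    exact (extChartAt (𝓡 n) p).right_inv hy
  have hτ := contDiffAt_transition hx hxq
  have hτ2 : ContDiffAt ℝ 2 (transition x p) (extChartAt (𝓡 n) x x) := hτ.of_le ENat.LEInfty.out
  have hG := m.isMetricOn_inChart x
  have hG' := m.isMetricOn_inChart p
  have hty := transition_mem_target hxq
  have hev := eventually_inChart_eq_transition hx hxq m
  -- The tangent space at x is identified with ℝⁿ by the preferred chart at x, so the derivative of
  -- that chart at its centre is the identity and the intrinsic Ricci bound is literally a bound on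
  -- components.
  have hid : chartDeriv x (extChartAt (𝓡 n) x x) = ContinuousLinearMap.id ℝ (Euc n) := by
    have := mfderivWithin_range_extChartAt_symm (I := 𝓡 n) (x := x)
    rw [ModelWithCorners.range_eq_univ, mfderivWithin_univ] at this
    exact this
  have hvec (v : Euc n) : vecCoord x (v : TangentSpace (𝓡 n) x) = v := by
    unfold vecCoord
    rw [mfderiv_extChartAt_self]
    rfl
  have hK (v : Fin n → ℝ) : K * ∑ i, ∑ j, m.inChart x (extChartAt (𝓡 n) x x) i j * v i * v j
      ≤ ∑ i, ∑ j, LocalGeometry.ricci (m.inChart x) i j (extChartAt (𝓡 n) x x) * v i * v j := by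
    have h1 := m.sum_inChart x (extChartAt (𝓡 n) x x) (WithLp.toLp 2 v) (WithLp.toLp 2 v)
    rw [hid, hself] at h1
    have h2 := hRic x (WithLp.toLp 2 v : Euc n)
    simp only [SmoothMetric.ricci] at h2
    rw [hvec] at h2
    exact (congrArg (K * ·) h1).trans_le h2
  -- The inequality is proved at x in the preferred chart for f composed with the transition map,
  -- then carried to the chart around p by invariance of its three terms.
  have key := hG.curvatureDimension (f := fun z ↦ f (transition x p z)) hx hK
    ((hf.contDiffAt.comp _ hτ).of_le ENat.LEInfty.out)
  rw [hG.curvatureTerm_comp hx hG' hty hτ2 hev (hf.contDiffAt.of_le ENat.LEInfty.out),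
    hG.laplacian_comp hx hG' hty hτ2 hev (hf.contDiffAt.of_le ENat.LEInfty.out),
    hG.gradInner_comp hx hG' hty hτ2 hev (hf.contDiffAt.of_le ENat.LEInfty.out)
      (hf.contDiffAt.of_le ENat.LEInfty.out), ht] at key
  exact key

end Global

end SmoothMetric

/-! ### Integration in charts and finite partitions of unity. -/

namespace LocalGeometry

open Filter Topology Matrix MeasureTheory

variable {n : ℕ}

lemma det_fderiv_eq_det_jacobian {τ : Euc n → Euc n} {y : Euc n} (hτ : DifferentiableAt ℝ τ y) :
    (fderiv ℝ τ y).det = (jacobian τ y).det := by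
  have h : LinearMap.toMatrix (EuclideanSpace.basisFun (Fin n) ℝ).toBasis
      (EuclideanSpace.basisFun (Fin n) ℝ).toBasis (fderiv ℝ τ y : Euc n →ₗ[ℝ] Euc n)
      = jacobian τ y := by
    ext a i
    rw [LinearMap.toMatrix_apply]
    simp [fderiv_apply_eq_jacobian hτ]
  rw [← h, LinearMap.det_toMatrix]

end LocalGeometry

namespace SmoothMetric

open Filter Topology Matrix MeasureTheory LocalGeometry

variable {n : ℕ} {M : Type*} [TopologicalSpace M]
  [ChartedSpace (EuclideanSpace ℝ (Fin n)) M] [IsManifold (𝓡 n) ∞ M]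

/-- The integral, with respect to the Riemannian volume, of a function over the domain of the chart
around `p`. -/
noncomputable def chartIntegral (m : SmoothMetric n M) (p : M) (f : M → ℝ) : ℝ :=
  ∫ y in (extChartAt (𝓡 n) p).target, read p f y * volDensity (m.inChart p) y

/-- From det G = (det J)² det G', the density acquires exactly the factor |det J| of the change of
variables formula. -/
lemma volDensity_transition (m : SmoothMetric n M) {p q : M} {y : Euc n}
    (hy : y ∈ (extChartAt (𝓡 n) p).target)
    (hyq : (extChartAt (𝓡 n) p).symm y ∈ (extChartAt (𝓡 n) q).source) :
    volDensity (m.inChart p) y = |(fderiv ℝ (transition p q) y).det|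
      * volDensity (m.inChart q) (transition p q y) := by
  rw [det_fderiv_eq_det_jacobian ((contDiffAt_transition hy hyq).differentiableAt (by simp))]
  unfold volDensity
  rw [inChart_eq_transition hy hyq, Matrix.det_mul, Matrix.det_mul, Matrix.det_transpose,
    ← Real.sqrt_sq_eq_abs, ← Real.sqrt_mul (sq_nonneg _)]
  congr 1; ring

/-- The integral of a function supported in two charts does not depend on the chart. -/
lemma chartIntegral_eq (m : SmoothMetric n M) {p q : M} {f : M → ℝ}
    (hp : ∀ x ∉ (extChartAt (𝓡 n) p).source, f x = 0)
    (hq : ∀ x ∉ (extChartAt (𝓡 n) q).source, f x = 0) :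
    m.chartIntegral p f = m.chartIntegral q f := by
  set φ := extChartAt (𝓡 n) p with hφ
  set ψ := extChartAt (𝓡 n) q with hψ
  have hφo : IsOpen φ.target := isOpen_extChartAt_target p
  have hψo : IsOpen ψ.target := isOpen_extChartAt_target q
  -- Since f vanishes off either chart domain, both integrals reduce to the overlap, of which A and
  -- its image under the transition map are the two coordinate pictures.
  let A : Set (Euc n) := φ.target ∩ φ.symm ⁻¹' ψ.source
  have hAo : IsOpen A := (continuousOn_extChartAt_symm p).isOpen_inter_preimage hφo
    (isOpen_extChartAt_source q)
  have himg : transition p q '' A = ψ.target ∩ ψ.symm ⁻¹' φ.source := by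
    ext y
    constructor
    · rintro ⟨z, ⟨h1, h2⟩, rfl⟩
      exact ⟨ψ.map_source h2, by
        change ψ.symm (ψ (φ.symm z)) ∈ φ.source
        rw [ψ.left_inv h2]; exact φ.map_target h1⟩
    · rintro ⟨h1, h2⟩
      refine ⟨φ (ψ.symm y), ⟨φ.map_source h2, ?_⟩, ?_⟩
      · change φ.symm (φ (ψ.symm y)) ∈ ψ.source
        rw [φ.left_inv h2]; exact ψ.map_target h1
      · change ψ (φ.symm (φ (ψ.symm y))) = y
        rw [φ.left_inv h2, ψ.right_inv h1]
  have hinj : Set.InjOn (transition p q) A := by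
    intro z hz z' hz' h
    have h1 : φ.symm z = φ.symm z' := ψ.injOn hz.2 hz'.2 h
    exact φ.symm.injOn hz.1 hz'.1 h1
  have h1 : m.chartIntegral p f = ∫ y in A, read p f y * volDensity (m.inChart p) y := by
    refine (setIntegral_eq_of_subset_of_forall_sdiff_eq_zero hφo.measurableSet
      Set.inter_subset_left fun y hy ↦ ?_)
    have : φ.symm y ∉ ψ.source := fun h ↦ hy.2 ⟨hy.1, h⟩
    simp only [read, Function.comp_apply, ← hφ, hq _ this, zero_mul]
  have h2 : m.chartIntegral q f = ∫ y in transition p q '' A,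
      read q f y * volDensity (m.inChart q) y := by
    rw [himg]
    refine (setIntegral_eq_of_subset_of_forall_sdiff_eq_zero hψo.measurableSet
      Set.inter_subset_left fun y hy ↦ ?_)
    have : ψ.symm y ∉ φ.source := fun h ↦ hy.2 ⟨hy.1, h⟩
    simp only [read, Function.comp_apply, ← hψ, hp _ this, zero_mul]
  rw [h1, h2, integral_image_eq_integral_abs_det_fderiv_smul volume hAo.measurableSet
    (fun y hy ↦ ((contDiffAt_transition hy.1 hy.2).differentiableAt
      (by simp)).hasFDerivAt.hasFDerivWithinAt) hinj]
  refine setIntegral_congr_fun hAo.measurableSet fun y hy ↦ ?_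
  simp only [smul_eq_mul]
  rw [m.volDensity_transition hy.1 hy.2]
  have : read q f (transition p q y) = read p f y := by
    simp only [read, Function.comp_apply, symm_transition hy.2]
  rw [this]; ring

section Compact

variable [CompactSpace M] (m : SmoothMetric n M) {p : M} {f h : M → ℝ}

omit [IsManifold (𝓡 n) ∞ M] in
lemma isCompact_image_tsupport (hf : tsupport f ⊆ (extChartAt (𝓡 n) p).source) :
    IsCompact (extChartAt (𝓡 n) p '' tsupport f) :=
  (isClosed_tsupport f).isCompact.image_of_continuousOn ((continuousOn_extChartAt p).mono hf)

omit [IsManifold (𝓡 n) ∞ M] [CompactSpace M] in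
lemma image_tsupport_subset (hf : tsupport f ⊆ (extChartAt (𝓡 n) p).source) :
    extChartAt (𝓡 n) p '' tsupport f ⊆ (extChartAt (𝓡 n) p).target := by
  rintro _ ⟨x, hx, rfl⟩
  exact (extChartAt (𝓡 n) p).map_source (hf hx)

omit [IsManifold (𝓡 n) ∞ M] [CompactSpace M] in
lemma read_eq_zero_of_notMem {y : Euc n} (hy : y ∈ (extChartAt (𝓡 n) p).target)
    (hyf : y ∉ extChartAt (𝓡 n) p '' tsupport f) : read p f y = 0 := by
  by_contra h0
  exact hyf ⟨_, subset_tsupport f h0, (extChartAt (𝓡 n) p).right_inv hy⟩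

lemma integrableOn_read (hf : Continuous f) (hs : tsupport f ⊆ (extChartAt (𝓡 n) p).source) :
    IntegrableOn (fun y ↦ read p f y * volDensity (m.inChart p) y)
      (extChartAt (𝓡 n) p).target := by
  refine integrableOn_of_continuousOn_of_zero (isOpen_extChartAt_target p)
    (isCompact_image_tsupport hs) (image_tsupport_subset hs) ?_ fun y hy hyf ↦ by
      rw [read_eq_zero_of_notMem hy hyf, zero_mul]
  exact (hf.comp_continuousOn (continuousOn_extChartAt_symm p)).mul
    (m.isMetricOn_inChart p).continuousOn_volDensity

lemma chartIntegral_add (hf : Continuous f) (hs : tsupport f ⊆ (extChartAt (𝓡 n) p).source)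
    (hh : Continuous h) (hsh : tsupport h ⊆ (extChartAt (𝓡 n) p).source) :
    m.chartIntegral p (fun x ↦ f x + h x) = m.chartIntegral p f + m.chartIntegral p h := by
  unfold chartIntegral
  rw [← integral_add (m.integrableOn_read hf hs) (m.integrableOn_read hh hsh)]
  congr 1; ext y
  simp only [read, Function.comp_apply]; ring

omit [CompactSpace M] in
lemma chartIntegral_const_mul (c : ℝ) :
    m.chartIntegral p (fun x ↦ c * f x) = c * m.chartIntegral p f := by
  unfold chartIntegral
  rw [← integral_const_mul]
  congr 1; ext y
  simp only [read, Function.comp_apply]; ring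

lemma chartIntegral_sum {ι : Type*} (s : Finset ι) {F : ι → M → ℝ}
    (hF : ∀ a ∈ s, Continuous (F a))
    (hs : ∀ a ∈ s, tsupport (F a) ⊆ (extChartAt (𝓡 n) p).source) :
    m.chartIntegral p (fun x ↦ ∑ a ∈ s, F a x) = ∑ a ∈ s, m.chartIntegral p (F a) := by
  unfold chartIntegral
  rw [← integral_finsetSum _ fun a ha ↦ m.integrableOn_read (hF a ha) (hs a ha)]
  congr 1; ext y
  simp only [read, Function.comp_apply, Finset.sum_mul]

lemma eq_zero_of_chartIntegral_eq_zero (hf : Continuous f)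
    (hs : tsupport f ⊆ (extChartAt (𝓡 n) p).source) (h0 : ∀ x, 0 ≤ f x)
    (hi : m.chartIntegral p f = 0) (x : M) : f x = 0 := by
  by_cases hx : x ∈ (extChartAt (𝓡 n) p).source
  swap
  · exact image_eq_zero_of_notMem_tsupport fun h ↦ hx (hs h)
  have hG := m.isMetricOn_inChart p
  have hnn : ∀ y ∈ (extChartAt (𝓡 n) p).target,
      0 ≤ read p f y * volDensity (m.inChart p) y := fun y hy ↦
    mul_nonneg (h0 _) (hG.volDensity_pos hy).le
  have h1 := (setIntegral_eq_zero_iff_of_nonneg_ae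
    ((ae_restrict_iff' hG.isOpen.measurableSet).2 (Eventually.of_forall hnn))
    (m.integrableOn_read hf hs)).1 hi
  have hc : ContinuousOn (fun y ↦ read p f y * volDensity (m.inChart p) y)
      (extChartAt (𝓡 n) p).target :=
    (hf.comp_continuousOn (continuousOn_extChartAt_symm p)).mul hG.continuousOn_volDensity
  -- Vanishing almost everywhere becomes vanishing everywhere on the open target, by continuity; the
  -- positive density is then divided out.
  have h2 := Measure.eqOn_open_of_ae_eq h1 hG.isOpen hc continuousOn_const
  have hy := (extChartAt (𝓡 n) p).map_source hx
  have h3 := h2 hy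
  have h4 : read p f (extChartAt (𝓡 n) p x) = f x := by
    simp only [read, Function.comp_apply, (extChartAt (𝓡 n) p).left_inv hx]
  simp only [h4, Pi.zero_apply, mul_eq_zero, (hG.volDensity_pos hy).ne', or_false] at h3
  exact h3

end Compact

end SmoothMetric

/-- A finite smooth partition of unity on `M` whose functions are supported in charts. -/
structure ChartPartition (n : ℕ) (M : Type*) [TopologicalSpace M]
    [ChartedSpace (EuclideanSpace ℝ (Fin n)) M] (ι : Type*) [Fintype ι] where
  /-- The centers of the charts. -/
  center : ι → M
  /-- The functions of the partition. -/
  toFun : ι → M → ℝ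
  contMDiff : ∀ i, ContMDiff (𝓡 n) 𝓘(ℝ, ℝ) ∞ (toFun i)
  nonneg : ∀ i x, 0 ≤ toFun i x
  sum_eq_one : ∀ x, ∑ i, toFun i x = 1
  tsupport_subset : ∀ i, tsupport (toFun i) ⊆ (extChartAt (𝓡 n) (center i)).source

namespace SmoothMetric

open Filter Topology Matrix MeasureTheory LocalGeometry

variable {n : ℕ} {M : Type*} [TopologicalSpace M]
  [ChartedSpace (EuclideanSpace ℝ (Fin n)) M] [IsManifold (𝓡 n) ∞ M]

lemma exists_chartPartition [T2Space M] [CompactSpace M] :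
    ∃ t : Finset M, Nonempty (ChartPartition n M t) := by
  obtain ⟨t, -, ht⟩ := isCompact_univ.elim_nhds_subcover
    (fun p : M ↦ (extChartAt (𝓡 n) p).source) fun p _ ↦ extChartAt_source_mem_nhds p
  obtain ⟨ρ, hρ⟩ := SmoothPartitionOfUnity.exists_isSubordinate (𝓡 n) isClosed_univ
    (fun p : t ↦ (extChartAt (𝓡 n) (p : M)).source) (fun p ↦ isOpen_extChartAt_source _)
    fun x hx ↦ by
      obtain ⟨p, hp, hxp⟩ := Set.mem_iUnion₂.1 (ht hx)
      exact Set.mem_iUnion.2 ⟨⟨p, hp⟩, hxp⟩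
  exact ⟨t, ⟨{
    center := fun p ↦ p
    toFun := fun p ↦ ρ p
    contMDiff := fun p ↦ (ρ p).contMDiff
    nonneg := fun p x ↦ ρ.nonneg p x
    sum_eq_one := fun x ↦ by
      rw [← finsum_eq_sum_of_fintype]; exact ρ.sum_eq_one (Set.mem_univ x)
    tsupport_subset := fun p ↦ hρ p }⟩⟩

/-! ### Integration on a compact manifold -/

/-- The integral with respect to the Riemannian volume, computed with a partition of unity. -/
noncomputable def volIntegral (m : SmoothMetric n M) {ι : Type*} [Fintype ι]
    (P : ChartPartition n M ι) (f : M → ℝ) : ℝ :=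
  ∑ i, m.chartIntegral (P.center i) fun x ↦ P.toFun i x * f x

section VolIntegral

variable [CompactSpace M] (m : SmoothMetric n M) {ι : Type*} [Fintype ι]
  (P : ChartPartition n M ι) {f h u w : M → ℝ} {p : M}

omit [IsManifold (𝓡 n) ∞ M] [CompactSpace M] in
lemma tsupport_partition_mul_subset (i : ι) (f : M → ℝ) :
    tsupport (fun x ↦ P.toFun i x * f x) ⊆ (extChartAt (𝓡 n) (P.center i)).source :=
  (tsupport_mul_subset_left (f := P.toFun i) (g := f)).trans (P.tsupport_subset i)

lemma volIntegral_add (hf : Continuous f) (hh : Continuous h) :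
    m.volIntegral P (fun x ↦ f x + h x) = m.volIntegral P f + m.volIntegral P h := by
  unfold volIntegral
  rw [← Finset.sum_add_distrib]
  refine Finset.sum_congr rfl fun i _ ↦ ?_
  simp only [mul_add]
  exact m.chartIntegral_add ((P.contMDiff i).continuous.mul hf)
    (tsupport_partition_mul_subset P i f) ((P.contMDiff i).continuous.mul hh)
    (tsupport_partition_mul_subset P i h)

omit [CompactSpace M] in
lemma volIntegral_const_mul (c : ℝ) :
    m.volIntegral P (fun x ↦ c * f x) = c * m.volIntegral P f := by
  unfold volIntegral
  rw [Finset.mul_sum]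
  refine Finset.sum_congr rfl fun i _ ↦ ?_
  rw [← chartIntegral_const_mul]
  simp only [mul_left_comm]

lemma volIntegral_sum {κ : Type*} (s : Finset κ) {F : κ → M → ℝ}
    (hF : ∀ a ∈ s, Continuous (F a)) :
    m.volIntegral P (fun x ↦ ∑ a ∈ s, F a x) = ∑ a ∈ s, m.volIntegral P (F a) := by
  unfold volIntegral
  rw [Finset.sum_comm]
  refine Finset.sum_congr rfl fun i _ ↦ ?_
  simp only [Finset.mul_sum]
  exact m.chartIntegral_sum s (fun a ha ↦ (P.contMDiff i).continuous.mul (hF a ha))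
    fun a _ ↦ tsupport_partition_mul_subset P i (F a)

/-- The integral of a function supported in a chart is computed in that chart. -/
lemma volIntegral_eq_chartIntegral (hf : Continuous f)
    (hs : tsupport f ⊆ (extChartAt (𝓡 n) p).source) :
    m.volIntegral P f = m.chartIntegral p f := by
  have hsi (i : ι) : tsupport (fun x ↦ P.toFun i x * f x) ⊆ (extChartAt (𝓡 n) p).source :=
    (tsupport_mul_subset_right (f := P.toFun i) (g := f)).trans hs
  have h1 (i : ι) : m.chartIntegral (P.center i) (fun x ↦ P.toFun i x * f x)
      = m.chartIntegral p fun x ↦ P.toFun i x * f x :=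
    m.chartIntegral_eq
      (fun x hx ↦ image_eq_zero_of_notMem_tsupport (f := fun x ↦ P.toFun i x * f x)
        fun h ↦ hx (tsupport_partition_mul_subset P i f h))
      (fun x hx ↦ image_eq_zero_of_notMem_tsupport (f := fun x ↦ P.toFun i x * f x)
        fun h ↦ hx (hsi i h))
  unfold volIntegral
  simp only [h1]
  rw [← m.chartIntegral_sum _ (F := fun i x ↦ P.toFun i x * f x) (fun i _ ↦ (P.contMDiff i).continuous.mul hf) fun i _ ↦ hsi i]
  simp only [← Finset.sum_mul, P.sum_eq_one, one_mul]

/-- A continuous non-positive function with non-negative integral vanishes. -/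
lemma eq_zero_of_volIntegral_nonneg (hf : Continuous f) (h0 : ∀ x, f x ≤ 0)
    (hi : 0 ≤ m.volIntegral P f) (x : M) : f x = 0 := by
  have hneg : m.volIntegral P (fun x ↦ -f x) = -m.volIntegral P f := by
    simpa using m.volIntegral_const_mul P (f := f) (-1)
  have hnn (i : ι) (x : M) : 0 ≤ P.toFun i x * -f x :=
    mul_nonneg (P.nonneg i x) (neg_nonneg.2 (h0 x))
  have hin (i : ι) : 0 ≤ m.chartIntegral (P.center i) fun x ↦ P.toFun i x * -f x :=
    setIntegral_nonneg (isOpen_extChartAt_target _).measurableSet fun y hy ↦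
      mul_nonneg (hnn i _) ((m.isMetricOn_inChart _).volDensity_pos hy).le
  have hsum : ∑ i, m.chartIntegral (P.center i) (fun x ↦ P.toFun i x * -f x) = 0 :=
    le_antisymm (by change m.volIntegral P (fun x ↦ -f x) ≤ 0; rw [hneg]; linarith)
      (Finset.sum_nonneg fun i _ ↦ hin i)
  have h1 (i : ι) : P.toFun i x * -f x = 0 :=
    m.eq_zero_of_chartIntegral_eq_zero ((P.contMDiff i).continuous.mul hf.neg)
      (tsupport_partition_mul_subset P i _) (hnn i)
      ((Finset.sum_eq_zero_iff_of_nonneg fun i _ ↦ hin i).1 hsum i (Finset.mem_univ i)) x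
  have h2 : ∑ i, P.toFun i x * -f x = 0 := Finset.sum_eq_zero fun i _ ↦ h1 i
  rw [← Finset.sum_mul, P.sum_eq_one] at h2
  linarith

end VolIntegral

/-! ### The Laplacian and the weighted Bochner inequality -/

section Support

variable (m : SmoothMetric n M) {u w : M → ℝ} {p x : M}

omit [IsManifold (𝓡 n) ∞ M] in
lemma read_eventuallyEq_zero (hw : x ∉ tsupport w) :
    read x w =ᶠ[𝓝 (extChartAt (𝓡 n) x x)] fun _ ↦ 0 := by
  have h1 : w =ᶠ[𝓝 x] 0 := notMem_tsupport_iff_eventuallyEq.1 hw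
  have h2 := continuousAt_extChartAt_symm (I := 𝓡 n) x
  have h3 := (extChartAt (𝓡 n) x).left_inv (mem_extChartAt_source x)
  rw [ContinuousAt, h3] at h2
  exact h2.eventually h1

lemma laplacian_eq_zero_of_notMem (hw : x ∉ tsupport w) : m.laplacian w x = 0 := by
  have h := laplacian_congr (G := m.inChart x) (read_eventuallyEq_zero hw)
  refine h.trans ?_
  have hp (j : Fin n) : partialDeriv j (fun _ : Euc n ↦ (0 : ℝ)) = fun _ ↦ 0 :=
    funext fun y ↦ partialDeriv_const j 0
  simp [LocalGeometry.laplacian, hessian, hp]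

lemma gradInner_eq_zero_of_notMem (hw : x ∉ tsupport w) : m.gradInner u w x = 0 := by
  have h := gradInner_congr_right (G := m.inChart x) (read_eventuallyEq_zero hw) (read x u)
  refine h.trans ?_
  simp [LocalGeometry.gradInner, grad, partialDeriv_const]

lemma tsupport_laplacian_subset : tsupport (m.laplacian w) ⊆ tsupport w :=
  closure_minimal (fun x hx ↦ by
    by_contra h
    exact hx (m.laplacian_eq_zero_of_notMem h)) (isClosed_tsupport w)

/-- The integrand of the weighted Bochner inequality on `M`. -/
noncomputable def bochnerTerm (K : ℝ) (w u : M → ℝ) (x : M) : ℝ :=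
  m.gradInner u u x * m.laplacian w x / 2 + m.laplacian u x * m.gradInner u w x
    + w x * (m.laplacian u x ^ 2 - m.laplacian u x ^ 2 / n) - K * w x * m.gradInner u u x

/-- Every term contains w or a derivative of w, so localizing w alone localizes the whole integrand,
with u left untouched. -/
lemma tsupport_bochnerTerm_subset (K : ℝ) : tsupport (m.bochnerTerm K w u) ⊆ tsupport w :=
  closure_minimal (fun x hx ↦ by
    by_contra h
    refine hx ?_
    simp [bochnerTerm, m.laplacian_eq_zero_of_notMem h, m.gradInner_eq_zero_of_notMem h,
      image_eq_zero_of_notMem_tsupport h]) (isClosed_tsupport w)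

lemma continuous_bochnerTerm (K : ℝ) (hw : ContMDiff (𝓡 n) 𝓘(ℝ, ℝ) 2 w)
    (hu : ContMDiff (𝓡 n) 𝓘(ℝ, ℝ) 2 u) : Continuous (m.bochnerTerm K w u) := by
  have h1 := m.continuous_laplacian hu
  have h2 := m.continuous_laplacian hw
  have h3 := m.continuous_gradInner hu hu
  have h4 := m.continuous_gradInner hu hw
  have h5 := hw.continuous
  unfold bochnerTerm
  fun_prop

/-- A function supported in a chart, in the coordinates of the chart and extended by zero. -/
noncomputable def readExt (p : M) (w : M → ℝ) : Euc n → ℝ :=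
  (extChartAt (𝓡 n) p).target.indicator (read p w)

omit [IsManifold (𝓡 n) ∞ M] in
lemma readExt_eventuallyEq {y : Euc n} (hy : y ∈ (extChartAt (𝓡 n) p).target) :
    readExt p w =ᶠ[𝓝 y] read p w := by
  filter_upwards [(isOpen_extChartAt_target p).mem_nhds hy] with z hz
    using Set.indicator_of_mem hz _

omit [IsManifold (𝓡 n) ∞ M] in
lemma readExt_eq_zero_of_notMem {y : Euc n} (hy : y ∉ extChartAt (𝓡 n) p '' tsupport w) :
    readExt p w y = 0 := by
  by_cases h : y ∈ (extChartAt (𝓡 n) p).target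
  · rw [readExt, Set.indicator_of_mem h, read_eq_zero_of_notMem h hy]
  · exact Set.indicator_of_notMem h _

lemma contDiffAt_readExt (hw : ContMDiff (𝓡 n) 𝓘(ℝ, ℝ) 2 w) {y : Euc n}
    (hy : y ∈ (extChartAt (𝓡 n) p).target) : ContDiffAt ℝ 2 (readExt p w) y :=
  (contDiffAt_read ENat.LEInfty.out hy (hw _)).congr_of_eventuallyEq (readExt_eventuallyEq hy)

lemma read_laplacian (hw : ContMDiff (𝓡 n) 𝓘(ℝ, ℝ) 2 w) {y : Euc n}
    (hy : y ∈ (extChartAt (𝓡 n) p).target) :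
    read p (m.laplacian w) y = LocalGeometry.laplacian (m.inChart p) (read p w) y := by
  have := m.laplacian_eq_chart ((extChartAt (𝓡 n) p).map_target hy) (hw _)
  rwa [(extChartAt (𝓡 n) p).right_inv hy] at this

lemma read_gradInner (hu : ContMDiff (𝓡 n) 𝓘(ℝ, ℝ) 2 u) (hw : ContMDiff (𝓡 n) 𝓘(ℝ, ℝ) 2 w)
    {y : Euc n} (hy : y ∈ (extChartAt (𝓡 n) p).target) :
    read p (m.gradInner u w) y
      = LocalGeometry.gradInner (m.inChart p) (read p u) (read p w) y := by
  have := m.gradInner_eq_chart ((extChartAt (𝓡 n) p).map_target hy) (hu _) (hw _)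
  rwa [(extChartAt (𝓡 n) p).right_inv hy] at this

variable [CompactSpace M]

/-- Green's formula with the constant multiplier 1. -/
lemma chartIntegral_laplacian (hw : ContMDiff (𝓡 n) 𝓘(ℝ, ℝ) 2 w)
    (hs : tsupport w ⊆ (extChartAt (𝓡 n) p).source) :
    m.chartIntegral p (m.laplacian w) = 0 := by
  have hG := m.isMetricOn_inChart p
  have hg := (hG.integral_green (h := fun _ ↦ 1) (f := readExt p w) (isCompact_image_tsupport hs)
    (image_tsupport_subset hs) (fun y _ ↦ contDiffAt_const) (fun y hy ↦ contDiffAt_readExt hw hy)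
    fun y hy k ↦ by
      rw [grad_eq_zero_of_notMem _ (isCompact_image_tsupport hs)
        (fun z hz ↦ readExt_eq_zero_of_notMem hz) hy, mul_zero]).2
  rw [← hg]
  refine setIntegral_congr_fun hG.isOpen.measurableSet fun y hy ↦ ?_
  have h0 : LocalGeometry.gradInner (m.inChart p) (fun _ ↦ 1) (readExt p w) y = 0 := by
    simp [LocalGeometry.gradInner, partialDeriv_const]
  simp only [m.read_laplacian hw hy, h0, laplacian_congr (readExt_eventuallyEq hy), one_mul,
    add_zero]

lemma chartIntegral_bochnerTerm_nonneg {K : ℝ} (hRic : m.RicciBoundedBelow K)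
    (hu : ContMDiff (𝓡 n) 𝓘(ℝ, ℝ) 2 u) (hw : ContMDiff (𝓡 n) 𝓘(ℝ, ℝ) 2 w) (hw0 : ∀ x, 0 ≤ w x)
    (hs : tsupport w ⊆ (extChartAt (𝓡 n) p).source) :
    0 ≤ m.chartIntegral p (m.bochnerTerm K w u) := by
  have hG := m.isMetricOn_inChart p
  -- The weight must vanish off a compact subset of ℝⁿ, while `read p w` takes arbitrary values off
  -- the chart target, hence `readExt`. The function u is only used on the target and needs no
  -- extension.
  have h := hG.integral_bochnerIntegrand_nonneg (K := K) (f := read p u) (w := readExt p w)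
    (isCompact_image_tsupport hs) (image_tsupport_subset hs)
    (fun f y hy hf ↦ m.curvatureDimension_inChart hRic p f y hy hf)
    (fun y hy ↦ contDiffAt_read ENat.LEInfty.out hy (hu _)) (fun y hy ↦ contDiffAt_readExt hw hy)
    (fun y hy ↦ by rw [readExt, Set.indicator_of_mem hy]; exact hw0 _)
    (fun y hy ↦ readExt_eq_zero_of_notMem hy)
  refine h.trans_eq (setIntegral_congr_fun hG.isOpen.measurableSet fun y hy ↦ ?_)
  have e := readExt_eventuallyEq (w := w) hy
  simp only [bochnerIntegrand, laplacian_congr e, gradInner_congr_right e, e.self_of_nhds,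
    ← m.read_laplacian hu hy, ← m.read_laplacian hw hy, ← m.read_gradInner hu hu hy,
    ← m.read_gradInner hu hw hy]
  rfl

variable {ι : Type*} [Fintype ι] (P : ChartPartition n M ι)

omit [IsManifold (𝓡 n) ∞ M] [CompactSpace M] in
lemma contMDiff_partition_mul (hw : ContMDiff (𝓡 n) 𝓘(ℝ, ℝ) 2 w) (i : ι) :
    ContMDiff (𝓡 n) 𝓘(ℝ, ℝ) 2 fun x ↦ P.toFun i x * w x :=
  ((P.contMDiff i).of_le ENat.LEInfty.out).mul hw

omit [IsManifold (𝓡 n) ∞ M] [CompactSpace M] in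
lemma sum_partition_mul (w : M → ℝ) : (fun x ↦ ∑ i, P.toFun i x * w x) = w := by
  ext x
  rw [← Finset.sum_mul, P.sum_eq_one, one_mul]

/-- The integral of a Laplacian vanishes. -/
theorem volIntegral_laplacian (hw : ContMDiff (𝓡 n) 𝓘(ℝ, ℝ) 2 w) :
    m.volIntegral P (m.laplacian w) = 0 := by
  have hwi := contMDiff_partition_mul P hw
  have h1 : m.laplacian w = fun x ↦ ∑ i, m.laplacian (fun x ↦ P.toFun i x * w x) x := by
    ext x
    conv_lhs => rw [← sum_partition_mul P w]
    exact m.laplacian_fun_sum _ (fun i _ ↦ hwi i) x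
  rw [h1, m.volIntegral_sum P _ fun i _ ↦ m.continuous_laplacian (hwi i)]
  refine Finset.sum_eq_zero fun i _ ↦ ?_
  have hs := tsupport_partition_mul_subset P i w
  rw [m.volIntegral_eq_chartIntegral P (m.continuous_laplacian (hwi i))
    (m.tsupport_laplacian_subset.trans hs), m.chartIntegral_laplacian (hwi i) hs]

/-- The weighted Bochner inequality on a compact manifold. -/
theorem volIntegral_bochnerTerm_nonneg {K : ℝ} (hRic : m.RicciBoundedBelow K)
    (hu : ContMDiff (𝓡 n) 𝓘(ℝ, ℝ) 2 u) (hw : ContMDiff (𝓡 n) 𝓘(ℝ, ℝ) 2 w)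
    (hw0 : ∀ x, 0 ≤ w x) : 0 ≤ m.volIntegral P (m.bochnerTerm K w u) := by
  have hwi := contMDiff_partition_mul P hw
  have h1 : m.bochnerTerm K w u
      = fun x ↦ ∑ i, m.bochnerTerm K (fun x ↦ P.toFun i x * w x) u x := by
    ext x
    have e1 : m.laplacian w x = ∑ i, m.laplacian (fun x ↦ P.toFun i x * w x) x := by
      conv_lhs => rw [← sum_partition_mul P w]
      exact m.laplacian_fun_sum _ (fun i _ ↦ hwi i) x
    have e2 : m.gradInner u w x = ∑ i, m.gradInner u (fun x ↦ P.toFun i x * w x) x := by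
      conv_lhs => rw [← sum_partition_mul P w]
      exact m.gradInner_fun_sum _ (fun i _ ↦ hwi i) x
    have e3 : w x = ∑ i, P.toFun i x * w x := (congrFun (sum_partition_mul P w) x).symm
    -- The integrand is linear in the weight, so it splits along w = ∑ ρᵢ w.
    simp only [bochnerTerm, Finset.sum_add_distrib, Finset.sum_sub_distrib, ← Finset.sum_div,
      ← Finset.mul_sum, ← Finset.sum_mul, ← e1, ← e2, P.sum_eq_one, one_mul]
  rw [h1, m.volIntegral_sum P _ fun i _ ↦ m.continuous_bochnerTerm K (hwi i) hu]
  refine Finset.sum_nonneg fun i _ ↦ ?_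
  have hs := tsupport_partition_mul_subset P i w
  rw [m.volIntegral_eq_chartIntegral P (m.continuous_bochnerTerm K (hwi i) hu)
    ((m.tsupport_bochnerTerm_subset K).trans hs)]
  exact m.chartIntegral_bochnerTerm_nonneg hRic hu (hwi i)
    (fun x ↦ mul_nonneg (P.nonneg i x) (hw0 x)) hs

/-- Integrating `Δ H(u)` for a `C²` function `H`. -/
lemma volIntegral_comp_real (hu : ContMDiff (𝓡 n) 𝓘(ℝ, ℝ) 2 u) {H H' H'' : ℝ → ℝ}
    (hH : ∀ t, HasDerivAt H (H' t) t) (hH' : ∀ t, HasDerivAt H' (H'' t) t)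
    (hH'' : Continuous H'') :
    m.volIntegral P
      (fun x ↦ H' (u x) * m.laplacian u x + H'' (u x) * m.gradInner u u x) = 0 := by
  have c1 : ContDiff ℝ 1 H' := by
    rw [contDiff_one_iff_deriv]
    refine ⟨fun t ↦ (hH' t).differentiableAt, ?_⟩
    rwa [show deriv H' = H'' from funext fun t ↦ (hH' t).deriv]
  have c2 : ContDiff ℝ 2 H := by
    rw [show (2 : WithTop ℕ∞) = 1 + 1 by norm_num, contDiff_succ_iff_deriv]
    refine ⟨fun t ↦ (hH t).differentiableAt, by simp, ?_⟩
    rwa [show deriv H = H' from funext fun t ↦ (hH t).deriv]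
  have h := m.volIntegral_laplacian P (w := fun x ↦ H (u x)) (c2.contMDiff.comp hu)
  rwa [show m.laplacian (fun x ↦ H (u x)) = fun x ↦ H' (u x) * m.laplacian u x
      + H'' (u x) * m.gradInner u u x from
    funext fun x ↦ m.laplacian_comp_real hH (hH' _) (hu x)] at h

end Support

end SmoothMetric

/-! ### The integral inequality for solutions and the conclusion. -/

namespace SmoothMetric

variable {n : ℕ} {M : Type*} [TopologicalSpace M]
  [ChartedSpace (EuclideanSpace ℝ (Fin n)) M] [IsManifold (𝓡 n) ∞ M]

/-- The integral inequality satisfied by the non-negative solutions of `Δu = -g(u)` under a lower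
bound on the Ricci curvature. -/
theorem volIntegral_nonneg_of_solution [CompactSpace M] (hn : n ≠ 0) (m : SmoothMetric n M)
    {κ : ℝ} (hRic : m.RicciBoundedBelow (((n : ℝ) - 1) * κ)) {g : ℝ → ℝ} (hg : Continuous g)
    {u : M → ℝ} (hu : ContMDiff (𝓡 n) 𝓘(ℝ, ℝ) 2 u) (hu0 : ∀ x, 0 ≤ u x)
    (hsol : ∀ x, m.laplacian u x = -g (u x)) {ι : Type*} [Fintype ι]
    (P : ChartPartition n M ι) :
    0 ≤ m.volIntegral P fun x ↦ g (u x) * (2 * ((n : ℝ) - 1) * u x * g (u x) / n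
      - 3 * (∫ σ in (0 : ℝ)..u x, g σ) - ((n : ℝ) - 1) * κ * u x ^ 2) := by
  have hn' : (n : ℝ) ≠ 0 := Nat.cast_ne_zero.2 hn
  set K := ((n : ℝ) - 1) * κ with hK
  let G : ℝ → ℝ := fun t ↦ ∫ σ in (0 : ℝ)..t, g σ
  have hG (t : ℝ) : HasDerivAt G (g t) t := intervalIntegral.integral_hasDerivAt_right
    (hg.intervalIntegrable _ _) hg.aestronglyMeasurable.stronglyMeasurableAtFilter hg.continuousAt
  have hGc : Continuous G := continuous_iff_continuousAt.2 fun t ↦ (hG t).continuousAt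
  have hGG (t : ℝ) : HasDerivAt (fun t ↦ ∫ σ in (0 : ℝ)..t, G σ) (G t) t :=
    intervalIntegral.integral_hasDerivAt_right (hGc.intervalIntegrable _ _)
      hGc.aestronglyMeasurable.stronglyMeasurableAtFilter hGc.continuousAt
  -- Applied to the second primitive of g, this replaces ∫ g(u)|∇u|² by -∫ G(u)Δu; next, H = t³/6,
  -- with H'' = t, replaces ∫ u|∇u|² by -½∫ u²Δu.
  have e1 := m.volIntegral_comp_real P hu hGG hG hg
  have e2 := m.volIntegral_comp_real P hu (H := fun t ↦ t ^ 3 / 6) (H' := fun t ↦ t ^ 2 / 2)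
    (H'' := fun t ↦ t) (fun t ↦ ((hasDerivAt_pow 3 t).div_const 6).congr_deriv (by simp; ring))
    (fun t ↦ ((hasDerivAt_pow 2 t).div_const 2).congr_deriv (by simp)) continuous_id
  have e3 := m.volIntegral_bochnerTerm_nonneg P hRic hu hu hu0
  have cu := hu.continuous
  have cL := m.continuous_laplacian hu
  have cE := m.continuous_gradInner hu hu
  have cG : Continuous fun x ↦ G (u x) := hGc.comp cu
  have cg : Continuous fun x ↦ g (u x) := hg.comp cu
  -- The coefficients 3 and 2K are those that cancel every |∇u|² term: with w = u and Δu = -g(u),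
  -- twice the Bochner term contains -3g(u)|∇u|² - 2Ku|∇u|².
  have key : (fun x ↦ g (u x) * (2 * ((n : ℝ) - 1) * u x * g (u x) / n
      - 3 * (∫ σ in (0 : ℝ)..u x, g σ) - K * u x ^ 2))
      = fun x ↦ 2 * m.bochnerTerm K u u x
        + (3 * (G (u x) * m.laplacian u x + g (u x) * m.gradInner u u x)
          + 2 * K * (u x ^ 2 / 2 * m.laplacian u x + u x * m.gradInner u u x)) := by
    ext x
    simp only [bochnerTerm, hsol, G]
    field_simp
    ring
  have s1 := m.volIntegral_add P (f := fun x ↦ 2 * m.bochnerTerm K u u x)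
    (h := fun x ↦ 3 * (G (u x) * m.laplacian u x + g (u x) * m.gradInner u u x)
      + 2 * K * (u x ^ 2 / 2 * m.laplacian u x + u x * m.gradInner u u x))
    (continuous_const.mul (m.continuous_bochnerTerm K hu hu)) (by fun_prop)
  have s2 := m.volIntegral_add P
    (f := fun x ↦ 3 * (G (u x) * m.laplacian u x + g (u x) * m.gradInner u u x))
    (h := fun x ↦ 2 * K * (u x ^ 2 / 2 * m.laplacian u x + u x * m.gradInner u u x))
    (by fun_prop) (by fun_prop)
  rw [key, s1, s2, m.volIntegral_const_mul, m.volIntegral_const_mul, m.volIntegral_const_mul,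
    e1, e2]
  linarith

end SmoothMetric

/-- A continuous function on a connected space with values in a discrete subset is constant. -/
lemma exists_eq_const_of_mem_discrete {X Y : Type*} [TopologicalSpace X] [ConnectedSpace X]
    [TopologicalSpace Y] {S : Set Y} [DiscreteTopology S] {u : X → Y} (hu : Continuous u)
    (hmem : ∀ x, u x ∈ S) : ∃ c, ∀ x, u x = c := by
  obtain ⟨x₀⟩ := ‹ConnectedSpace X›.toNonempty
  refine ⟨u x₀, fun x ↦ ?_⟩
  have h := PreconnectedSpace.constant inferInstance (f := fun x ↦ (⟨u x, hmem x⟩ : S))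
    (hu.subtype_mk hmem) (x := x) (y := x₀)
  exact congrArg Subtype.val h

/-- A closed manifold is here compact, connected, Hausdorff and without boundary; a solution is
a classical (`C²`) solution. -/
theorem corollary1p9 (n : ℕ) {M : Type*} [TopologicalSpace M]
    [ChartedSpace (EuclideanSpace ℝ (Fin n)) M] [IsManifold (𝓡 n) ∞ M]
    [T2Space M] [CompactSpace M] [ConnectedSpace M]
    (m : SmoothMetric n M) (κ : ℝ) (hRic : m.RicciBoundedBelow (((n : ℝ) - 1) * κ))
    (g : ℝ → ℝ) (hg : Continuous g)
    (S : Set ℝ) (hS : S ⊆ Set.Ici 0) (hSd : DiscreteTopology S)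
    (hzero : ∀ t ∈ S,
      g t * (2 * ((n : ℝ) - 1) * t * g t / n - 3 * (∫ σ in (0 : ℝ)..t, g σ)
        - ((n : ℝ) - 1) * κ * t ^ 2) = 0)
    (hneg : ∀ t ∈ Set.Ici (0 : ℝ) \ S,
      g t * (2 * ((n : ℝ) - 1) * t * g t / n - 3 * (∫ σ in (0 : ℝ)..t, g σ)
        - ((n : ℝ) - 1) * κ * t ^ 2) < 0)
    (u : M → ℝ) (hu : ContMDiff (𝓡 n) 𝓘(ℝ, ℝ) 2 u) (hu0 : ∀ x, 0 ≤ u x)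
    (hsol : ∀ x, m.laplacian u x = -g (u x)) :
    ∃ c : ℝ, ∀ x, u x = c := by
  refine exists_eq_const_of_mem_discrete (S := S) hu.continuous fun x ↦ ?_
  by_contra hx
  have hlt := hneg (u x) ⟨hu0 x, hx⟩
  rcases Nat.eq_zero_or_pos n with hn | hn
  -- In dimension zero the Laplacian is an empty sum, so g(u) = 0 and the strict inequality at u x
  -- already fails.
  · subst hn
    have h0 : m.laplacian u x = 0 := by
      simp [SmoothMetric.laplacian, LocalGeometry.laplacian]
    rw [hsol, neg_eq_zero] at h0
    simp [h0] at hlt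
  obtain ⟨t, ⟨P⟩⟩ := SmoothMetric.exists_chartPartition (n := n) (M := M)
  refine hlt.ne (m.eq_zero_of_volIntegral_nonneg P (f := fun x ↦ g (u x) *
    (2 * ((n : ℝ) - 1) * u x * g (u x) / n - 3 * (∫ σ in (0 : ℝ)..u x, g σ)
      - ((n : ℝ) - 1) * κ * u x ^ 2)) ?_ (fun z ↦ ?_)
    (m.volIntegral_nonneg_of_solution hn.ne' hRic hg hu hu0 hsol P) x)
  · have hc : Continuous fun t ↦ ∫ σ in (0 : ℝ)..t, g σ :=
      intervalIntegral.continuous_primitive (fun a b ↦ hg.intervalIntegrable a b) 0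
    have h1 := hu.continuous
    have h2 := hg.comp h1
    have h3 := hc.comp h1
    simp only [Function.comp_def] at h2 h3
    fun_prop
  · by_cases hz : u z ∈ S
    · exact (hzero _ hz).le
    · exact (hneg _ ⟨hu0 z, hz⟩).le
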